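/- **Setting.** Let $k$ be a field and $N\hookrightarrow M$ an extension of $k$-algebras with an $N$-bimodule map $E:M\to N$, elements $x_1,\dots,x_n,y_1,\dots,y_n\in M$ and $\lambda\in k\setminus\{0\}$ such that $\sum_i E(mx_i)y_i=m=\sum_i x_iE(y_im)$ for all $m\in M$, $E(1)=1$ and $\sum_i x_iy_i=\sum_i y_ix_i=\lambda^{-1}1$. Let $T:N\to k$ be a linear trace with $T(1)=1$ such that $T\circ E$ is a trace on $M$. Put $U=C_M(N)$ (centralizer) and assume that $E(ux)=E(xu)$ for all $u\in U$, $x\in M$, that $U$ is Kanzaki separable (i.e. has a symmetric separability element, one fixed by the flip of $U\otimes U$), and that $T\circ E$ is non-degenerate on $U$. Let $M_1=\mathrm{End}(M_N)$ $(\cong M\otimes_N M)$ be the basic construction, containing $M$ as left multiplications and the Jones idempotent $e_1=E$, with conditional expectation $E_M:M_1\to M$, $E_M(me_1m')=\lambda mm'$. Let $M_2=\mathrm{End}((M_1)_M)$ be the basic construction of $M\hookrightarrow M_1$ in the same way, with $e_2=E_M$ and $E_{M_1}:M_2\to M_1$, $E_{M_1}(xe_2x')=\lambda xx'$. Write $V=C_{M_1}(M)$,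 $A=C_{M_1}(N)$, $B=C_{M_2}(M)$, and let $T$ also denote the traces $T\circ E\circ E_M$ on $M_1$ and $T\circ E\circ E_M\circ E_{M_1}$ on $M_2$. Assume the depth $2$ property: $E_M$ has dual bases in $A$, and $E_{M_1}$ has dual bases in $B$. **Statement.** The algebra $V$ has a unique symmetric separability element $f=f^{(1)}\otimes f^{(2)}$, the element $f^{(1)}T(f^{(2)})$ of $V$ is invertible, and with $w=[f^{(1)}T(f^{(2)})]^{-1}$ the bilinear form $$\langle a,b\rangle=\lambda^{-2}\,T(a\,e_2e_1w\,b)\qquad(a\in A,\ b\in B)$$ is a perfect pairing of $A$ and $B$. The algebra $B$ is a weak Hopf algebra with comultiplication, counit $\varepsilon$ and antipode $S$ determined by $$\langle a,b_{(1)}\rangle\langle a',b_{(2)}\rangle=\langle aa',b\rangle,\qquad \varepsilon(b)=\langle 1,b\rangle,\qquad \langle a,b\rangle=\lambda^{-2}\,T(S(b)\,e_1e_2w\,a),$$ and $A\cong B^*$ is a coalgebra with comultiplication and counit determined by $\langle a_{(1)},b\rangle\langle a_{(2)},b'\rangle=\langle a,bb'\rangle$ and $\varepsilon(a)=\langle a,1\rangle$.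 Moreover: 1. The map $B\otimes M_1\to M_1$, $b\triangleright x=\lambda^{-1}E_{M_1}(bxe_2)$, makes $M_1$ a left $B$-module algebra: it is a unital left module action with $b\triangleright(xy)=(b_{(1)}\triangleright x)(b_{(2)}\triangleright y)$ and $b\triangleright 1=\varepsilon_t(b)\triangleright 1$, where $\varepsilon_t(b)=\varepsilon(1_{(1)}b)1_{(2)}$. 2. $M_1=MA$, and $\triangleright$ is characterized as the only bilinear map $B\times M_1\to M_1$ satisfying $$b\triangleright ma=m\,\langle a_{(2)},b\rangle\,a_{(1)}\qquad(m\in M,\ a\in A,\ b\in B);$$ in particular $B$ acts on $A$ by $b\triangleright a=a_{(1)}\langle a_{(2)},b\rangle$, the standard action of $B$ on its dual. 3. The invariants $M_1^B=\{x\in M_1 : b\triangleright x=\varepsilon_t(b)\triangleright x\text{ for all }b\in B\}$ are exactly the subalgebra $M$. -/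

import Mathlib

open scoped TensorProduct

noncomputable section

/-! ### Weak Hopf algebras and their actions -/

section WeakHopf

variable (k : Type*) [Field k]

/-- A weak Hopf algebra structure on the `k`-algebra `H`. -/
structure WeakHopfAlgebra (H : Type*) [Ring H] [Algebra k H] extends Coalgebra k H where
  /-- `Δ(hg) = Δ(h)Δ(g)` -/
  comul_mul : ∀ h g : H, comul (h * g) = comul h * comul g
  /-- `ε(hgf) = ε(h g₍₁₎) ε(g₍₂₎ f)` -/
  counit_mul_left : ∀ h g f : H, counit (h * g * f) =
    LinearMap.mul' k k (TensorProduct.map (counit ∘ₗ LinearMap.mulLeft k h)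
      (counit ∘ₗ LinearMap.mulRight k f) (comul g))
  /-- `ε(hgf) = ε(h g₍₂₎) ε(g₍₁₎ f)` -/
  counit_mul_right : ∀ h g f : H, counit (h * g * f) =
    LinearMap.mul' k k (TensorProduct.map (counit ∘ₗ LinearMap.mulRight k f)
      (counit ∘ₗ LinearMap.mulLeft k h) (comul g))
  /-- `(Δ ⊗ id)Δ(1) = (Δ(1) ⊗ 1)(1 ⊗ Δ(1))` -/
  comul_one_left : LinearMap.rTensor H comul (comul 1) =
    ((comul 1) ⊗ₜ[k] (1 : H)) *
      (TensorProduct.assoc k H H H).symm ((1 : H) ⊗ₜ[k] (comul 1))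
  /-- `(Δ ⊗ id)Δ(1) = (1 ⊗ Δ(1))(Δ(1) ⊗ 1)` -/
  comul_one_right : LinearMap.rTensor H comul (comul 1) =
    (TensorProduct.assoc k H H H).symm ((1 : H) ⊗ₜ[k] (comul 1)) *
      ((comul 1) ⊗ₜ[k] (1 : H))
  /-- the antipode `S` -/
  antipode : H →ₗ[k] H
  /-- `h₍₁₎ S(h₍₂₎) = (ε ⊗ id)(Δ(1)(h ⊗ 1))` -/
  mul_antipode_right : ∀ h : H,
    LinearMap.mul' k H (TensorProduct.map LinearMap.id antipode (comul h)) =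
      TensorProduct.lid k H (LinearMap.rTensor H counit (comul 1 * (h ⊗ₜ[k] (1 : H))))
  /-- `S(h₍₁₎) h₍₂₎ = (id ⊗ ε)((1 ⊗ h)Δ(1))` -/
  mul_antipode_left : ∀ h : H,
    LinearMap.mul' k H (TensorProduct.map antipode LinearMap.id (comul h)) =
      TensorProduct.rid k H (LinearMap.lTensor H counit (((1 : H) ⊗ₜ[k] h) * comul 1))
  /-- `S(h₍₁₎) h₍₂₎ S(h₍₃₎) = S(h)` -/
  antipode_mul_antipode : ∀ h : H,
    LinearMap.mul' k H (TensorProduct.map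
      (LinearMap.mul' k H ∘ₗ TensorProduct.map antipode LinearMap.id) antipode
      (LinearMap.rTensor H comul (comul h))) = antipode h

variable {k}

/-- The target counital map `ε_t(h) = (ε ⊗ id)(Δ(1)(h ⊗ 1))`. -/
def WeakHopfAlgebra.targetCounit {H : Type*} [Ring H] [Algebra k H]
    (W : WeakHopfAlgebra k H) (h : H) : H :=
  TensorProduct.lid k H (LinearMap.rTensor H W.counit (W.comul 1 * (h ⊗ₜ[k] (1 : H))))

/-- The bilinear map `H × X → X` makes the algebra `X` a left `H`-module algebra. -/
structure WeakHopfAlgebra.IsModuleAlgebra {H X : Type*} [Ring H] [Algebra k H]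
    [Ring X] [Algebra k X] (W : WeakHopfAlgebra k H) (act : H →ₗ[k] X →ₗ[k] X) : Prop where
  one_act : ∀ x : X, act 1 x = x
  mul_act : ∀ (h g : H) (x : X), act (h * g) x = act h (act g x)
  /-- `h · xy = (h₍₁₎ · x)(h₍₂₎ · y)` -/
  act_mul : ∀ (h : H) (x y : X), act h (x * y) =
    LinearMap.mul' k X (TensorProduct.map (act.flip x) (act.flip y) (W.comul h))
  /-- `h · 1 = ε_t(h) · 1` -/
  act_one : ∀ h : H, act h 1 = act (W.targetCounit h) 1

/-- The invariants `X^H = {x | h · x = ε_t(h) · x for all h}`. -/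
def WeakHopfAlgebra.invariants {H X : Type*} [Ring H] [Algebra k H]
    [Ring X] [Algebra k X] (W : WeakHopfAlgebra k H) (act : H →ₗ[k] X →ₗ[k] X) : Set X :=
  {x | ∀ h : H, act h x = act (W.targetCounit h) x}

end WeakHopf

/-! ### Kanzaki separable algebras -/

section Kanzaki

variable (k : Type*) [Field k] {R : Type*} [Ring R] [Algebra k R]

/-- `f` is a symmetric separability element of `R`: `r f = f r` for all `r`,
`f⁽¹⁾ f⁽²⁾ = 1`, and `f` is fixed by the flip of `R ⊗ R`. -/
structure IsSymmSeparabilityElement (f : R ⊗[k] R) : Prop where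
  casimir : ∀ r : R, LinearMap.rTensor R (LinearMap.mulLeft k r) f =
    LinearMap.lTensor R (LinearMap.mulRight k r) f
  mul_eq_one : LinearMap.mul' k R f = 1
  symm : TensorProduct.comm k R R f = f

/-- Kanzaki separable algebras: those with a symmetric separability element. -/
def IsKanzakiSeparable (R : Type*) [Ring R] [Algebra k R] : Prop :=
  ∃ f : R ⊗[k] R, IsSymmSeparabilityElement k f

end Kanzaki

/-! ### Strongly separable extensions and the basic construction -/

/-- A strongly separable extension `S ↪ R` of `k`-algebras, with its Frobenius coordinates
`E`, `x i`, `y i` and the reciprocal `lam` of its index. The inclusion `incl` is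
automatically injective since `E (incl s) = s`. -/
structure StronglySeparableExt (k S R : Type*) [Field k] [Ring S] [Algebra k S]
    [Ring R] [Algebra k R] where
  incl : S →ₐ[k] R
  E : R →ₗ[k] S
  E_left : ∀ (s : S) (r : R), E (incl s * r) = s * E r
  E_right : ∀ (r : R) (s : S), E (r * incl s) = E r * s
  n : ℕ
  x : Fin n → R
  y : Fin n → R
  dual_left : ∀ r : R, ∑ i, incl (E (r * x i)) * y i = r
  dual_right : ∀ r : R, ∑ i, x i * incl (E (y i * r)) = r
  E_one : E 1 = 1
  lam : k
  lam_ne_zero : lam ≠ 0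
  index : ∑ i, x i * y i = algebraMap k R lam⁻¹

namespace StronglySeparableExt

section Basic

variable {k S R : Type*} [Field k] [Ring S] [Algebra k S] [Ring R] [Algebra k R]

/-- The algebra `End(R_S)` of endomorphisms of the right `S`-module `R`. -/
def rightEnd (D : StronglySeparableExt k S R) : Subalgebra k (Module.End k R) where
  carrier := {f | ∀ (r : R) (s : S), f (r * D.incl s) = f r * D.incl s}
  mul_mem' := by
    intro f g hf hg r s
    simp only [Set.mem_ofPred_eq] at hf hg
    simp [Module.End.mul_apply, hf, hg]
  add_mem' := by
    intro f g hf hg r s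
    simp only [Set.mem_ofPred_eq] at hf hg
    simp [hf, hg, add_mul]
  algebraMap_mem' := by
    intro c r s
    simp [Module.algebraMap_end_apply]

/-- The basic construction `R₁ = R ⊗_S R`, in its form `R₁ ≅ End(R_S)`, under which
`r e₁ r'` is the endomorphism `ℓ_r E ℓ_{r'}` (`ℓ` denotes left multiplication). -/
def Alg (D : StronglySeparableExt k S R) : Type _ := ↥D.rightEnd

instance (D : StronglySeparableExt k S R) : Ring D.Alg := inferInstanceAs (Ring ↥D.rightEnd)

instance (D : StronglySeparableExt k S R) : Algebra k D.Alg :=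
  inferInstanceAs (Algebra k ↥D.rightEnd)

/-- The endomorphism of `R` underlying an element of the basic construction. -/
def toEnd (D : StronglySeparableExt k S R) : D.Alg →ₐ[k] Module.End k R := D.rightEnd.val

theorem toEnd_injective (D : StronglySeparableExt k S R) : Function.Injective D.toEnd :=
  Subtype.val_injective

theorem toEnd_mul_incl (D : StronglySeparableExt k S R) (f : D.Alg) (r : R) (s : S) :
    D.toEnd f (r * D.incl s) = D.toEnd f r * D.incl s := f.2 r s

/-- The inclusion `R ↪ R₁`, by left multiplications. -/
def leftMul (D : StronglySeparableExt k S R) : R →ₐ[k] D.Alg :=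
  (Algebra.lmul k R).codRestrict D.rightEnd (fun r r' s => by simp [mul_assoc])

@[simp] theorem toEnd_leftMul (D : StronglySeparableExt k S R) (r r' : R) :
    D.toEnd (D.leftMul r) r' = r * r' := rfl

/-- The Jones idempotent `e₁`, i.e. `E` viewed as an endomorphism of `R_S`. -/
def jones (D : StronglySeparableExt k S R) : D.Alg :=
  ⟨D.incl.toLinearMap ∘ₗ D.E, fun r s => by simp [D.E_right]⟩

@[simp] theorem toEnd_jones (D : StronglySeparableExt k S R) (r : R) :
    D.toEnd D.jones r = D.incl (D.E r) := rfl

/-- The conditional expectation `R₁ → R`, `f ↦ lam ∑ f(x i) y i`; see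
`condExp_leftMul_jones_leftMul` for the formula `r e₁ r' ↦ lam r r'`. -/
def condExp (D : StronglySeparableExt k S R) : D.Alg →ₗ[k] R where
  toFun f := D.lam • ∑ i, D.toEnd f (D.x i) * D.y i
  map_add' f g := by simp [add_mul, Finset.sum_add_distrib]
  map_smul' c f := by simp [Finset.smul_sum, smul_comm c]

theorem condExp_apply (D : StronglySeparableExt k S R) (f : D.Alg) :
    D.condExp f = D.lam • ∑ i, D.toEnd f (D.x i) * D.y i := rfl

theorem condExp_mul_leftMul (D : StronglySeparableExt k S R) (f : D.Alg) (r : R) :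
    D.condExp (f * D.leftMul r) = D.condExp f * r := by
  have h : ∀ i, D.toEnd f (r * D.x i) =
      ∑ j, D.toEnd f (D.x j) * D.incl (D.E (D.y j * (r * D.x i))) := by
    intro i
    conv_lhs => rw [← D.dual_right (r * D.x i)]
    rw [map_sum]
    exact Finset.sum_congr rfl fun j _ => D.toEnd_mul_incl f _ _
  have h2 : ∑ i, D.toEnd f (r * D.x i) * D.y i = (∑ j, D.toEnd f (D.x j) * D.y j) * r := by
    calc ∑ i, D.toEnd f (r * D.x i) * D.y i
        = ∑ i, ∑ j, D.toEnd f (D.x j) * D.incl (D.E (D.y j * (r * D.x i))) * D.y i := by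
          refine Finset.sum_congr rfl fun i _ => ?_
          rw [h i, Finset.sum_mul]
      _ = ∑ j, D.toEnd f (D.x j) * ∑ i, D.incl (D.E (D.y j * r * D.x i)) * D.y i := by
          rw [Finset.sum_comm]
          refine Finset.sum_congr rfl fun j _ => ?_
          rw [Finset.mul_sum]
          exact Finset.sum_congr rfl fun i _ => by simp only [mul_assoc]
      _ = _ := by
          rw [Finset.sum_mul]
          refine Finset.sum_congr rfl fun j _ => ?_
          rw [D.dual_left, mul_assoc]
  simp only [condExp_apply, map_mul, Module.End.mul_apply, toEnd_leftMul]
  rw [h2, smul_mul_assoc]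

theorem condExp_leftMul_mul (D : StronglySeparableExt k S R) (r : R) (f : D.Alg) :
    D.condExp (D.leftMul r * f) = r * D.condExp f := by
  simp only [condExp_apply, map_mul, Module.End.mul_apply, toEnd_leftMul]
  rw [mul_smul_comm, Finset.mul_sum]
  simp only [mul_assoc]

theorem condExp_jones (D : StronglySeparableExt k S R) :
    D.condExp D.jones = algebraMap k R D.lam := by
  have h := D.dual_left 1
  simp only [one_mul] at h
  simp only [condExp_apply, toEnd_jones]
  rw [h, Algebra.algebraMap_eq_smul_one]

theorem condExp_leftMul_jones_leftMul (D : StronglySeparableExt k S R) (r r' : R) :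
    D.condExp (D.leftMul r * D.jones * D.leftMul r') = D.lam • (r * r') := by
  rw [condExp_mul_leftMul, condExp_leftMul_mul, condExp_jones, ← Algebra.commutes,
    mul_assoc, Algebra.smul_def]

theorem sum_toEnd_jones (D : StronglySeparableExt k S R) (f : D.Alg) :
    ∑ i, D.leftMul (D.toEnd f (D.x i)) * D.jones * D.leftMul (D.y i) = f := by
  apply D.toEnd_injective
  ext r
  simp only [map_sum, map_mul, LinearMap.sum_apply, Module.End.mul_apply, toEnd_leftMul,
    toEnd_jones]
  conv_rhs => rw [← D.dual_right r, map_sum]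
  exact Finset.sum_congr rfl fun i _ => (D.toEnd_mul_incl f _ _).symm

theorem jones_leftMul_jones (D : StronglySeparableExt k S R) (r : R) :
    D.jones * D.leftMul r * D.jones = D.leftMul (D.incl (D.E r)) * D.jones := by
  apply D.toEnd_injective
  ext r'
  simp [D.E_right]

theorem jones_leftMul_mul (D : StronglySeparableExt k S R) (s : S) :
    D.jones * D.leftMul (D.incl s) = D.leftMul (D.incl s) * D.jones := by
  apply D.toEnd_injective
  ext r'
  simp [D.E_left]

/-- The basic construction `R ↪ R₁` is again a strongly separable extension of the same
index, with conditional expectation `condExp` and dual bases `lam⁻¹ x i e₁`, `e₁ y i`. -/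
def basic (D : StronglySeparableExt k S R) : StronglySeparableExt k R D.Alg where
  incl := D.leftMul
  E := D.condExp
  E_left := D.condExp_leftMul_mul
  E_right := D.condExp_mul_leftMul
  n := D.n
  x i := D.lam⁻¹ • (D.leftMul (D.x i) * D.jones)
  y i := D.jones * D.leftMul (D.y i)
  dual_left f := by
    have h : ∀ i, D.condExp (f * (D.lam⁻¹ • (D.leftMul (D.x i) * D.jones))) =
        D.toEnd f (D.x i) := by
      intro i
      rw [mul_smul_comm, map_smul, ← mul_assoc]
      conv_lhs => rw [← D.sum_toEnd_jones (f * D.leftMul (D.x i))]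
      simp only [Finset.sum_mul, map_sum, mul_assoc]
      simp only [← mul_assoc, map_mul, Module.End.mul_apply, toEnd_leftMul]
      have h3 : ∀ j, D.condExp (D.leftMul (D.toEnd f (D.x i * D.x j)) * D.jones *
          D.leftMul (D.y j) * D.jones) =
          D.lam • (D.toEnd f (D.x i * D.x j) * D.incl (D.E (D.y j))) := by
        intro j
        rw [mul_assoc (D.leftMul _) D.jones, mul_assoc, D.jones_leftMul_jones, ← mul_assoc,
          ← map_mul, condExp_leftMul_mul, condExp_jones, ← Algebra.commutes,
          Algebra.smul_def]
      simp only [h3]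
      rw [← Finset.smul_sum, inv_smul_smul₀ D.lam_ne_zero]
      conv_rhs => rw [← mul_one (D.x i), ← D.dual_right 1]
      simp only [mul_one, Finset.mul_sum, map_sum]
      refine Finset.sum_congr rfl fun j _ => ?_
      rw [← mul_assoc, D.toEnd_mul_incl]
    simp only [h]
    simp only [← mul_assoc]
    exact D.sum_toEnd_jones f
  dual_right f := by
    have h : ∀ i, D.lam⁻¹ • (D.leftMul (D.x i) * D.jones) *
        D.leftMul (D.condExp (D.jones * D.leftMul (D.y i) * f)) =
        ∑ j, D.leftMul (D.x i * D.incl (D.E (D.y i * D.toEnd f (D.x j)))) * D.jones *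
          D.leftMul (D.y j) := by
      intro i
      simp only [condExp_apply, map_mul, Module.End.mul_apply, toEnd_leftMul, toEnd_jones,
        map_smul, smul_mul_assoc, mul_smul_comm]
      rw [smul_inv_smul₀ D.lam_ne_zero, map_sum, Finset.mul_sum]
      refine Finset.sum_congr rfl fun j _ => ?_
      rw [map_mul, ← mul_assoc, mul_assoc _ D.jones, D.jones_leftMul_mul, ← mul_assoc]
    simp only [h]
    rw [Finset.sum_comm]
    conv_rhs => rw [← D.sum_toEnd_jones f]
    refine Finset.sum_congr rfl fun j _ => ?_
    rw [← Finset.sum_mul, ← Finset.sum_mul, ← map_sum, D.dual_right]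
  E_one := by
    simp only [condExp_apply, map_one, Module.End.one_apply]
    rw [D.index, Algebra.algebraMap_eq_smul_one, smul_smul, mul_inv_cancel₀ D.lam_ne_zero,
      one_smul]
  lam := D.lam
  lam_ne_zero := D.lam_ne_zero
  index := by
    have hj : D.jones * D.jones = D.jones := by
      have := D.jones_leftMul_jones 1
      simpa [D.E_one] using this
    have h := D.sum_toEnd_jones 1
    simp only [map_one, Module.End.one_apply] at h
    have h2 : ∀ i, D.lam⁻¹ • (D.leftMul (D.x i) * D.jones) * (D.jones * D.leftMul (D.y i)) =
        D.lam⁻¹ • (D.leftMul (D.x i) * D.jones * D.leftMul (D.y i)) := by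
      intro i
      rw [smul_mul_assoc, ← mul_assoc, mul_assoc _ D.jones D.jones, hj]
    simp only [h2]
    rw [← Finset.smul_sum, h, Algebra.algebraMap_eq_smul_one]

/-- The finite families `z`, `w` are dual bases for `E`. -/
def IsDualBases (D : StronglySeparableExt k S R) {m : ℕ} (z w : Fin m → R) : Prop :=
  (∀ r : R, ∑ j, D.incl (D.E (r * z j)) * w j = r) ∧
    (∀ r : R, ∑ j, z j * D.incl (D.E (w j * r)) = r)

end Basic

/-! ### The Jones tower `N ↪ M ↪ M₁ ↪ M₂` and its centralizers

Below `D` is the extension `N ↪ M`, so that `M₁ = D.Alg`, `D.basic` is the extension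
`M ↪ M₁`, `M₂ = D.basic.Alg`, and `D.basic.basic` has inclusion `M₁ ↪ M₂` and conditional
expectation `E_{M₁} : M₂ → M₁`. The Jones idempotents are `e₁ = D.jones` and
`e₂ = D.basic.jones`. -/

section Tower

variable {k N M : Type*} [Field k] [Ring N] [Algebra k N] [Ring M] [Algebra k M]

/-- `U = C_M(N)`. -/
def U (D : StronglySeparableExt k N M) : Subalgebra k M :=
  Subalgebra.centralizer k (Set.range D.incl)

/-- `V = C_{M₁}(M)`. -/
def V (D : StronglySeparableExt k N M) : Subalgebra k D.Alg :=
  Subalgebra.centralizer k (Set.range D.basic.incl)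

/-- `A = C_{M₁}(N)`. -/
def A (D : StronglySeparableExt k N M) : Subalgebra k D.Alg :=
  Subalgebra.centralizer k (Set.range (D.basic.incl.comp D.incl))

/-- `B = C_{M₂}(M)`. -/
def B (D : StronglySeparableExt k N M) : Subalgebra k D.basic.Alg :=
  Subalgebra.centralizer k (Set.range (D.basic.basic.incl.comp D.basic.incl))

/-- `T : N → k` is a Markov trace: it is a normalized trace and `T₀ = T ∘ E` is a trace. -/
structure IsMarkovTrace (D : StronglySeparableExt k N M) (T : N →ₗ[k] k) : Prop where
  trace : ∀ a b : N, T (a * b) = T (b * a)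
  one : T 1 = 1
  trace_comp : ∀ a b : M, T (D.E (a * b)) = T (D.E (b * a))

/-- `E(ux) = E(xu)` for all `u ∈ U`, `x ∈ M`. -/
def IsSymmetric (D : StronglySeparableExt k N M) : Prop :=
  ∀ u ∈ D.U, ∀ x : M, D.E (u * x) = D.E (x * u)

/-- The trace `T ∘ E` is non-degenerate on `U`. -/
def TraceNondegOnU (D : StronglySeparableExt k N M) (T : N →ₗ[k] k) : Prop :=
  ∀ u ∈ D.U, (∀ u' ∈ D.U, T (D.E (u * u')) = 0) → u = 0

/-- The depth 2 property: `E_M` has dual bases in `A`, and `E_{M₁}` has dual bases in `B`. -/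
def IsDepthTwo (D : StronglySeparableExt k N M) : Prop :=
  (∃ (m : ℕ) (z w : Fin m → D.Alg), (∀ j, z j ∈ D.A ∧ w j ∈ D.A) ∧ D.basic.IsDualBases z w) ∧
    (∃ (m : ℕ) (u v : Fin m → D.basic.Alg), (∀ i, u i ∈ D.B ∧ v i ∈ D.B) ∧
      D.basic.basic.IsDualBases u v)

/-- The trace `T₁ = T E E_M` of `M₁`. -/
def trace₁ (D : StronglySeparableExt k N M) (T : N →ₗ[k] k) : D.Alg →ₗ[k] k :=
  T ∘ₗ D.E ∘ₗ D.basic.E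

/-- The trace `T₂ = T E E_M E_{M₁}` of `M₂`. -/
def trace₂ (D : StronglySeparableExt k N M) (T : N →ₗ[k] k) : D.basic.Alg →ₗ[k] k :=
  D.trace₁ T ∘ₗ D.basic.basic.E

/-- The element `f⁽¹⁾ T(f⁽²⁾)` of `V`, for `f ∈ V ⊗ V`. -/
def sliceTrace (D : StronglySeparableExt k N M) (T : N →ₗ[k] k) (f : D.V ⊗[k] D.V) : D.V :=
  TensorProduct.rid k D.V (LinearMap.lTensor D.V (D.trace₁ T ∘ₗ D.V.val.toLinearMap) f)

/-- The inclusion `A ↪ M₁ ↪ M₂`. -/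
def inclA (D : StronglySeparableExt k N M) : D.A →ₐ[k] D.basic.Alg :=
  D.basic.basic.incl.comp D.A.val

/-- The inclusion `V ↪ M₁ ↪ M₂`. -/
def inclV (D : StronglySeparableExt k N M) : D.V →ₐ[k] D.basic.Alg :=
  D.basic.basic.incl.comp D.V.val

/-- The Jones idempotent `e₁`, viewed in `M₂`. -/
def e₁ (D : StronglySeparableExt k N M) : D.basic.Alg := D.basic.basic.incl D.jones

/-- The Jones idempotent `e₂ ∈ M₂`. -/
def e₂ (D : StronglySeparableExt k N M) : D.basic.Alg := D.basic.jones

/-- The bilinear form `⟨a, b⟩ = lam⁻² T(a e₂ e₁ w b)` on `A × B`. -/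
def pairing (D : StronglySeparableExt k N M) (T : N →ₗ[k] k) (w : D.V) :
    D.A →ₗ[k] D.B →ₗ[k] k :=
  LinearMap.mk₂ k
    (fun a b => (D.lam⁻¹) ^ 2 * D.trace₂ T (D.inclA a * D.e₂ * D.e₁ * D.inclV w * (b : D.basic.Alg)))
    (fun a a' b => by simp only [map_add, add_mul, mul_add])
    (fun c a b => by simp only [map_smul, smul_mul_assoc, smul_eq_mul]; ring)
    (fun a b b' => by simp only [Subalgebra.coe_add, map_add, mul_add])
    (fun c a b => by
      simp only [Subalgebra.coe_smul, map_smul, mul_smul_comm, smul_eq_mul]; ring)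

/-- The map `b ▷ x = lam⁻¹ E_{M₁}(b x e₂)`. -/
def act (D : StronglySeparableExt k N M) : D.B →ₗ[k] D.Alg →ₗ[k] D.Alg :=
  LinearMap.mk₂ k
    (fun b x => D.lam⁻¹ • D.basic.basic.E ((b : D.basic.Alg) * D.basic.basic.incl x * D.e₂))
    (fun b b' x => by simp only [Subalgebra.coe_add, add_mul, map_add, smul_add])
    (fun c b x => by
      simp only [Subalgebra.coe_smul, smul_mul_assoc, map_smul]; rw [smul_comm])
    (fun b x x' => by simp only [map_add, add_mul, mul_add, smul_add])
    (fun c b x => by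
      simp only [map_smul, smul_mul_assoc, mul_smul_comm]; rw [smul_comm])

/-- The weak Hopf algebra structure on `B` obtained from the pairing with the algebra `A`:
`⟨a, b₍₁₎⟩⟨a', b₍₂₎⟩ = ⟨aa', b⟩`, `ε(b) = ⟨1, b⟩` and
`⟨a, b⟩ = lam⁻² T(S(b) e₁ e₂ w a)`. -/
structure IsCanonicalOnB (D : StronglySeparableExt k N M) (T : N →ₗ[k] k) (w : D.V)
    (W : WeakHopfAlgebra k D.B) : Prop where
  comul : ∀ (a a' : D.A) (b : D.B),
    LinearMap.mul' k k (TensorProduct.map (D.pairing T w a) (D.pairing T w a') (W.comul b)) =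
      D.pairing T w (a * a') b
  counit : ∀ b : D.B, W.counit b = D.pairing T w 1 b
  antipode : ∀ (a : D.A) (b : D.B), D.pairing T w a b = (D.lam⁻¹) ^ 2 *
    D.trace₂ T ((W.antipode b : D.basic.Alg) * D.e₁ * D.e₂ * D.inclV w * D.inclA a)

/-- The coalgebra structure on `A` dual to the algebra `B`:
`⟨a₍₁₎, b⟩⟨a₍₂₎, b'⟩ = ⟨a, bb'⟩` and `ε(a) = ⟨a, 1⟩`. -/
structure IsCanonicalOnA (D : StronglySeparableExt k N M) (T : N →ₗ[k] k) (w : D.V)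
    (CA : Coalgebra k D.A) : Prop where
  comul : ∀ (a : D.A) (b b' : D.B),
    LinearMap.mul' k k (TensorProduct.map ((D.pairing T w).flip b) ((D.pairing T w).flip b')
      (CA.comul a)) = D.pairing T w a (b * b')
  counit : ∀ a : D.A, CA.counit a = D.pairing T w a 1

/-- The standard action `b ⇀ a = a₍₁₎ ⟨a₍₂₎, b⟩` of `B` on its dual `A`. -/
def standardAct (D : StronglySeparableExt k N M) (T : N →ₗ[k] k) (w : D.V)
    (CA : Coalgebra k D.A) (b : D.B) (a : D.A) : D.A :=
  TensorProduct.rid k D.A (LinearMap.lTensor D.A ((D.pairing T w).flip b) (CA.comul a))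

end Tower

end StronglySeparableExt

end

/-! The algebra `B` consists of the `M`-`M`-bimodule endomorphisms of `M₁`, and `λ⁻¹ E_{M₁}(b x e₂)`
is simply `b(x)` (`act_apply`). Such an endomorphism preserves `A` and `V`, and is determined by its
restriction to `A` because `M₁ = MA`. The trace property and the two Jones idempotents turn the
pairing into `⟨a, b⟩ = ε(b(a))` with `ε(a) = T(E(a(1) w(1)))` (`pairing_apply`). It is perfect
because `T ∘ E` is non-degenerate on `U` and the dual bases carry this up to `A` and `B`. What
remains concerns an algebra `B` of operators on the symmetric algebra `A`; this is isolated in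
`GaloisSystem`.

Dual bases of `E_{M₁}` in `B` give, for each `b`, some `t = ∑ t₁ ⊗ t₂` in `B ⊗ B` with `b(xy) = ∑
t₁(x) t₂(y)` (`toEnd_mul_eq_sum`). This `t` need not be unique. Let `p ⊗ q` run through the
separability element of `V`, and put `Δ(1) = ∑ R(p) ⊗ L(q)`, where `R` and `L` are right and left
multiplications. The factor `w` makes `p`, `q` dual bases for `ε` on `V`, so that `∑ ε(xp) ε(qy) =
ε(xy)` (`sum_ε_mul`). Hence the dual comultiplication is `Δ(b) = Δ(1) t` for every such `t`
(`comul_eq`), and most axioms become identities between operators on `A`. The antipode is the trace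
adjoint conjugated by right multiplication by `w`: one antipode axiom is an adjunction, the other is
deduced from it by applying the product rule to the adjoint `b^*`.

The separability element of `V` is transported from `U` by the anti-isomorphism `V ≅ U`, `v ↦ v(1)`.
Finally `ε_t(b)` is left multiplication by `b(1)`, so an invariant `x` satisfies `b(x) = b(1) x`.
Since `e₂` lies in `M₁B`, this forces `E_M(x) = E_M(1) x = x`, that is, `x ∈ M`. -/

open scoped TensorProduct

noncomputable section

/-! ### Coalgebras from perfect pairings -/

section DualCoalgebra

variable {k A B C E : Type*} [Field k] [AddCommGroup B] [Module k B] [AddCommGroup C] [Module k C]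
  [AddCommGroup E] [Module k E]

/-- Product functionals separate the points of a tensor product over a field. -/
theorem TensorProduct.ext_functionals {s t : B ⊗[k] C}
    (h : ∀ (φ : B →ₗ[k] k) (ψ : C →ₗ[k] k),
      LinearMap.mul' k k (TensorProduct.map φ ψ s) = LinearMap.mul' k k (TensorProduct.map φ ψ t)) :
    s = t := by
  let b := Module.Basis.ofVectorSpace k B
  let c := Module.Basis.ofVectorSpace k C
  have key : ∀ (u : B ⊗[k] C) (i) (j), (b.tensorProduct c).repr u (i, j) =
      LinearMap.mul' k k (TensorProduct.map (b.coord i) (c.coord j) u) := by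
    intro u i j
    induction u with
    | zero => simp
    | add x y hx hy => simp [hx, hy]
    | tmul x y => simp [Module.Basis.tensorProduct_repr_tmul_apply, mul_comm]
  refine (b.tensorProduct c).ext_elem fun ⟨i, j⟩ => ?_
  rw [key, key, h]

theorem TensorProduct.ext_functionals₃ {s t : B ⊗[k] (C ⊗[k] E)}
    (h : ∀ (φ : B →ₗ[k] k) (ψ : C →ₗ[k] k) (χ : E →ₗ[k] k),
      LinearMap.mul' k k (TensorProduct.map φ (LinearMap.mul' k k ∘ₗ TensorProduct.map ψ χ) s) =
      LinearMap.mul' k k (TensorProduct.map φ (LinearMap.mul' k k ∘ₗ TensorProduct.map ψ χ) t)) :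
    s = t := by
  let b := Module.Basis.ofVectorSpace k B
  let c := Module.Basis.ofVectorSpace k C
  let e := Module.Basis.ofVectorSpace k E
  have key : ∀ (u : B ⊗[k] (C ⊗[k] E)) (i) (j) (l),
      (b.tensorProduct (c.tensorProduct e)).repr u (i, (j, l)) =
      LinearMap.mul' k k (TensorProduct.map (b.coord i)
        (LinearMap.mul' k k ∘ₗ TensorProduct.map (c.coord j) (e.coord l)) u) := by
    intro u i j l
    induction u with
    | zero => simp
    | add x y hx hy => simp [hx, hy]
    | tmul x y =>
      induction y with
      | zero => simp
      | add y z hy hz => simp only [TensorProduct.tmul_add, map_add, Finsupp.add_apply, hy, hz]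
      | tmul y z => simp [Module.Basis.tensorProduct_repr_tmul_apply, mul_comm]
  refine (b.tensorProduct (c.tensorProduct e)).ext_elem fun ⟨i, j, l⟩ => ?_
  rw [key, key, h]

variable [Ring A] [Algebra k A]

theorem LinearMap.IsPerfPair.exists_eq (p : A →ₗ[k] B →ₗ[k] k) (hp : p.IsPerfPair)
    (φ : B →ₗ[k] k) : ∃ a, p a = φ := hp.bijective_left.2 φ

theorem LinearMap.IsPerfPair.tensor_ext (p : A →ₗ[k] B →ₗ[k] k) (hp : p.IsPerfPair)
    {s t : B ⊗[k] B} (h : ∀ a a' : A,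
      LinearMap.mul' k k (TensorProduct.map (p a) (p a') s) =
      LinearMap.mul' k k (TensorProduct.map (p a) (p a') t)) : s = t := by
  refine TensorProduct.ext_functionals fun φ ψ => ?_
  obtain ⟨a, rfl⟩ := LinearMap.IsPerfPair.exists_eq p hp φ
  obtain ⟨a', rfl⟩ := LinearMap.IsPerfPair.exists_eq p hp ψ
  exact h a a'

/-- A finite-dimensional space in perfect duality with an algebra is a coalgebra. -/
theorem exists_coalgebra_of_isPerfPair [FiniteDimensional k B] (p : A →ₗ[k] B →ₗ[k] k)
    (hp : p.IsPerfPair) :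
    ∃ W : Coalgebra k B,
      (∀ (a a' : A) (b : B), LinearMap.mul' k k (TensorProduct.map (p a) (p a') (W.comul b)) =
        p (a * a') b) ∧ ∀ b : B, W.counit b = p 1 b := by
  let β := Module.finBasis k B
  -- The elements `α i` form the basis of `A` dual to `β`; the coefficients of `Δ` below are then
  -- forced by duality.
  choose α hα using fun i => LinearMap.IsPerfPair.exists_eq p hp (β.coord i)
  have hsum : ∀ a : A, a = ∑ i, p a (β i) • α i := by
    intro a
    apply hp.bijective_left.1
    refine β.ext fun j => ?_
    simp [hα]
  let Δ : B →ₗ[k] B ⊗[k] B := ∑ i, ∑ j, (p (α i * α j)).smulRight (β i ⊗ₜ[k] β j)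
  have hΔ : ∀ (a a' : A) (b : B), LinearMap.mul' k k (TensorProduct.map (p a) (p a') (Δ b)) =
        p (a * a') b := by
    intro a a' b
    conv_rhs => rw [hsum a, hsum a']
    simp only [Δ, LinearMap.sum_apply, map_sum, LinearMap.smulRight_apply, map_smul,
      TensorProduct.map_tmul, LinearMap.mul'_apply, Finset.sum_mul, Finset.mul_sum,
      smul_mul_assoc, mul_smul_comm, LinearMap.smul_apply, smul_eq_mul]
    conv_rhs => rw [Finset.sum_comm]
    refine Finset.sum_congr rfl fun i _ => Finset.sum_congr rfl fun j _ => by ring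
  refine ⟨{ comul := Δ, counit := p 1, coassoc := ?_, rTensor_counit_comp_comul := ?_,
            lTensor_counit_comp_comul := ?_ }, hΔ, fun b => rfl⟩
  · ext b
    refine TensorProduct.ext_functionals₃ fun φ ψ χ => ?_
    obtain ⟨a, rfl⟩ := LinearMap.IsPerfPair.exists_eq p hp φ
    obtain ⟨a', rfl⟩ := LinearMap.IsPerfPair.exists_eq p hp ψ
    obtain ⟨a'', rfl⟩ := LinearMap.IsPerfPair.exists_eq p hp χ
    have h1 : ∀ s : B ⊗[k] B, LinearMap.mul' k k (TensorProduct.map (p a)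
        (LinearMap.mul' k k ∘ₗ TensorProduct.map (p a') (p a''))
        (TensorProduct.assoc k B B B (Δ.rTensor B s))) =
        LinearMap.mul' k k (TensorProduct.map (p (a * a')) (p a'') s) := by
      intro s
      induction s with
      | zero => simp
      | add x y hx hy => simp only [map_add, hx, hy]
      | tmul x y =>
        have h2 : ∀ r : B ⊗[k] B, LinearMap.mul' k k (TensorProduct.map (p a)
            (LinearMap.mul' k k ∘ₗ TensorProduct.map (p a') (p a''))
            (TensorProduct.assoc k B B B (r ⊗ₜ[k] y))) =
            LinearMap.mul' k k (TensorProduct.map (p a) (p a') r) * p a'' y := by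
          intro r
          induction r with
          | zero => simp
          | add x y hx hy => simp only [TensorProduct.add_tmul, map_add, hx, hy, add_mul]
          | tmul x y => simp [mul_assoc]
        rw [LinearMap.rTensor_tmul, h2, hΔ]
        simp
    have h3 : ∀ s : B ⊗[k] B, LinearMap.mul' k k (TensorProduct.map (p a)
        (LinearMap.mul' k k ∘ₗ TensorProduct.map (p a') (p a'')) (Δ.lTensor B s)) =
        LinearMap.mul' k k (TensorProduct.map (p a) (p (a' * a'')) s) := by
      intro s
      induction s with
      | zero => simp
      | add x y hx hy => simp only [map_add, hx, hy]
      | tmul x y => simp [hΔ]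
    simp only [LinearMap.comp_apply, LinearEquiv.coe_coe]
    rw [h1, h3, hΔ, hΔ, mul_assoc]
  · ext b
    refine TensorProduct.ext_functionals fun φ ψ => ?_
    obtain ⟨a, rfl⟩ := LinearMap.IsPerfPair.exists_eq p hp ψ
    have h1 : ∀ s : B ⊗[k] B, LinearMap.mul' k k (TensorProduct.map φ (p a)
        ((p 1).rTensor B s)) =
        φ 1 * LinearMap.mul' k k (TensorProduct.map (p 1) (p a) s) := by
      intro s
      induction s with
      | zero => simp
      | add x y hx hy => simp only [map_add, hx, hy, mul_add]
      | tmul x y =>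
        have : φ (p 1 x) = φ 1 * p 1 x := by
          rw [← mul_one (p 1 x), ← smul_eq_mul, map_smul, smul_eq_mul, smul_eq_mul]; ring
        simp only [LinearMap.rTensor_tmul, TensorProduct.map_tmul, LinearMap.mul'_apply]
        rw [this, mul_assoc]
    simp only [LinearMap.comp_apply]
    rw [h1, hΔ]
    simp
  · ext b
    refine TensorProduct.ext_functionals fun ψ φ => ?_
    obtain ⟨a, rfl⟩ := LinearMap.IsPerfPair.exists_eq p hp ψ
    have h1 : ∀ s : B ⊗[k] B, LinearMap.mul' k k (TensorProduct.map (p a) φ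
        ((p 1).lTensor B s)) =
        LinearMap.mul' k k (TensorProduct.map (p a) (p 1) s) * φ 1 := by
      intro s
      induction s with
      | zero => simp
      | add x y hx hy => simp only [map_add, hx, hy, add_mul]
      | tmul x y =>
        have : φ (p 1 y) = p 1 y * φ 1 := by
          rw [← mul_one (p 1 y), ← smul_eq_mul, map_smul, smul_eq_mul, smul_eq_mul]
          ring
        simp only [LinearMap.lTensor_tmul, TensorProduct.map_tmul, LinearMap.mul'_apply]
        rw [this, mul_assoc]
    simp only [LinearMap.comp_apply]
    rw [h1, hΔ]
    simp

end DualCoalgebra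

/-! ### Symmetric separability elements -/

section SymmSep

variable {k R : Type*} [Field k] [Ring R] [Algebra k R]

namespace IsSymmSeparabilityElement

variable {f : R ⊗[k] R}

/-- `r f⁽¹⁾ ⊗ f⁽²⁾ = f⁽¹⁾ ⊗ f⁽²⁾ r`, seen through a linear map. -/
theorem map_casimir {P Q : Type*} [AddCommGroup P] [Module k P] [AddCommGroup Q] [Module k Q]
    (hf : IsSymmSeparabilityElement k f) (g : R →ₗ[k] P) (h : R →ₗ[k] Q) (r : R) :
    TensorProduct.map (g ∘ₗ LinearMap.mulLeft k r) h f =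
      TensorProduct.map g (h ∘ₗ LinearMap.mulRight k r) f := by
  have := congrArg (TensorProduct.map g h) (hf.casimir r)
  simpa only [LinearMap.rTensor, LinearMap.lTensor, ← TensorProduct.map_map,
    ← LinearMap.comp_apply, ← TensorProduct.map_comp, LinearMap.comp_id] using this

theorem map_symm {P Q : Type*} [AddCommGroup P] [Module k P] [AddCommGroup Q] [Module k Q]
    (hf : IsSymmSeparabilityElement k f) (g : R →ₗ[k] P) (h : R →ₗ[k] Q) :
    TensorProduct.comm k P Q (TensorProduct.map g h f) = TensorProduct.map h g f := by
  conv_rhs => rw [← hf.symm, TensorProduct.map_comm]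

/-- `f⁽¹⁾ r ⊗ f⁽²⁾ = f⁽¹⁾ ⊗ r f⁽²⁾`, seen through a linear map. -/
theorem map_casimir' {P Q : Type*} [AddCommGroup P] [Module k P] [AddCommGroup Q] [Module k Q]
    (hf : IsSymmSeparabilityElement k f) (g : R →ₗ[k] P) (h : R →ₗ[k] Q) (r : R) :
    TensorProduct.map (g ∘ₗ LinearMap.mulRight k r) h f =
      TensorProduct.map g (h ∘ₗ LinearMap.mulLeft k r) f := by
  rw [← hf.map_symm, ← hf.map_casimir, hf.map_symm]

theorem sum_mul_eq_one {s : Finset (R × R)} (hf : IsSymmSeparabilityElement k f)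
    (hs : f = ∑ i ∈ s, i.1 ⊗ₜ[k] i.2) : ∑ i ∈ s, i.1 * i.2 = 1 := by
  rw [← hf.mul_eq_one, hs, map_sum]
  rfl

theorem sum_mul_eq_one' {s : Finset (R × R)} (hf : IsSymmSeparabilityElement k f)
    (hs : f = ∑ i ∈ s, i.1 ⊗ₜ[k] i.2) : ∑ i ∈ s, i.2 * i.1 = 1 := by
  rw [← hf.mul_eq_one, ← hf.symm, hs, map_sum, map_sum]
  rfl

/-- The symmetric separability element is unique. -/
theorem unique {f' : R ⊗[k] R} (hf : IsSymmSeparabilityElement k f)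
    (hf' : IsSymmSeparabilityElement k f') : f' = f := by
  obtain ⟨s, hs⟩ := TensorProduct.exists_finset f
  obtain ⟨s', hs'⟩ := TensorProduct.exists_finset f'
  -- With `f = ∑ p ⊗ q` and `f' = ∑ p' ⊗ q'`, the double sum `∑ pp' ⊗ q'q` collapses to `f` on
  -- moving `p'` across `f`, and to `f'` on moving `q` across `f'`.
  have h1 : ∑ j ∈ s', TensorProduct.map (LinearMap.mulRight k j.1) (LinearMap.mulLeft k j.2) f
      = f := by
    have h : ∀ j : R × R, TensorProduct.map (LinearMap.mulRight k j.1)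
        (LinearMap.mulLeft k j.2) f = TensorProduct.map LinearMap.id
          (LinearMap.mulLeft k (j.2 * j.1)) f := by
      intro j
      have := hf.map_casimir' LinearMap.id (LinearMap.mulLeft k j.2) j.1
      rwa [LinearMap.id_comp, ← LinearMap.mulLeft_mul] at this
    simp only [h]
    conv_rhs => rw [hs]
    simp only [hs, map_sum, TensorProduct.map_tmul, LinearMap.id_apply, LinearMap.mulLeft_apply]
    rw [Finset.sum_comm]
    refine Finset.sum_congr rfl fun i _ => ?_
    rw [← TensorProduct.tmul_sum, ← Finset.sum_mul, hf'.sum_mul_eq_one' hs', one_mul]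
  have h2 : ∑ i ∈ s, TensorProduct.map (LinearMap.mulLeft k i.1) (LinearMap.mulRight k i.2) f'
      = f' := by
    have h : ∀ j : R × R, TensorProduct.map (LinearMap.mulLeft k j.1)
        (LinearMap.mulRight k j.2) f' = TensorProduct.map
          (LinearMap.mulLeft k (j.1 * j.2)) LinearMap.id f' := by
      intro j
      have := hf'.map_casimir (LinearMap.mulLeft k j.1) LinearMap.id j.2
      rwa [LinearMap.id_comp, ← LinearMap.mulLeft_mul, eq_comm] at this
    simp only [h]
    conv_rhs => rw [hs']
    simp only [hs', map_sum, TensorProduct.map_tmul, LinearMap.id_apply, LinearMap.mulLeft_apply]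
    rw [Finset.sum_comm]
    refine Finset.sum_congr rfl fun i _ => ?_
    rw [← TensorProduct.sum_tmul, ← Finset.sum_mul, hf.sum_mul_eq_one hs, one_mul]
  rw [← h1, ← h2]
  conv_lhs => rw [hs']
  conv_rhs => rw [hs]
  simp only [map_sum, TensorProduct.map_tmul, LinearMap.mulLeft_apply, LinearMap.mulRight_apply]
  rw [Finset.sum_comm]

/-- Anti-isomorphisms preserve symmetric separability elements. -/
theorem map_anti {R' : Type*} [Ring R'] [Algebra k R'] (hf : IsSymmSeparabilityElement k f)
    (e : R ≃ₗ[k] R') (he : ∀ x y, e (x * y) = e y * e x) :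
    IsSymmSeparabilityElement k (TensorProduct.map e.toLinearMap e.toLinearMap f) := by
  have he1 : e 1 = 1 := by
    have h := he (e.symm 1) 1
    simpa using h.symm
  refine ⟨fun r => ?_, ?_, hf.map_symm _ _⟩
  · obtain ⟨r, rfl⟩ := e.surjective r
    have h1 : LinearMap.mulLeft k (e r) ∘ₗ e.toLinearMap =
        e.toLinearMap ∘ₗ LinearMap.mulRight k r := by ext x; simp [he]
    have h2 : LinearMap.mulRight k (e r) ∘ₗ e.toLinearMap =
        e.toLinearMap ∘ₗ LinearMap.mulLeft k r := by ext x; simp [he]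
    rw [← LinearMap.comp_apply, LinearMap.rTensor_comp_map, h1, hf.map_casimir', ← h2,
      ← LinearMap.lTensor_comp_map, LinearMap.comp_apply]
  · obtain ⟨s, hs⟩ := TensorProduct.exists_finset f
    have := congrArg e (hf.sum_mul_eq_one' hs)
    rw [map_sum, he1] at this
    rw [← this, hs]
    simp [he]

/-! ### Separability elements and non-degenerate traces. -/

section Trace

variable (τ : R →ₗ[k] k)

theorem sum_smul_casimir {s : Finset (R × R)} (hf : IsSymmSeparabilityElement k f)
    (hs : f = ∑ i ∈ s, i.1 ⊗ₜ[k] i.2) (r : R) :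
    ∑ i ∈ s, τ (i.2 * r) • i.1 = r * ∑ i ∈ s, τ i.2 • i.1 := by
  have := congrArg (TensorProduct.rid k R) (hf.map_casimir LinearMap.id τ r)
  rw [hs] at this
  simpa [Finset.mul_sum] using this.symm

theorem sum_smul_casimir' {s : Finset (R × R)} (hf : IsSymmSeparabilityElement k f)
    (hs : f = ∑ i ∈ s, i.1 ⊗ₜ[k] i.2) (r : R) :
    ∑ i ∈ s, τ (r * i.2) • i.1 = (∑ i ∈ s, τ i.2 • i.1) * r := by
  have := congrArg (TensorProduct.rid k R) (hf.map_casimir' LinearMap.id τ r)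
  rw [hs] at this
  simpa [Finset.sum_mul] using this.symm

theorem sum_smul_symm {s : Finset (R × R)} (hf : IsSymmSeparabilityElement k f)
    (hs : f = ∑ i ∈ s, i.1 ⊗ₜ[k] i.2) :
    ∑ i ∈ s, τ i.1 • i.2 = ∑ i ∈ s, τ i.2 • i.1 := by
  have := congrArg (TensorProduct.rid k R) (hf.map_symm τ LinearMap.id)
  rw [hs] at this
  simpa using this

/-- For a non-degenerate trace `τ`, the central element `f⁽¹⁾ τ(f⁽²⁾)` is invertible. -/
theorem exists_inverse (hf : IsSymmSeparabilityElement k f) (hτ : ∀ x y, τ (x * y) = τ (y * x))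
    (hnd : ∀ x, (∀ y, τ (x * y) = 0) → x = 0) :
    FiniteDimensional k R ∧ ∃ (w c : R) (s : Finset (R × R)),
      TensorProduct.rid k R (LinearMap.lTensor R τ f) = c ∧ w * c = 1 ∧ c * w = 1 ∧
      (∀ v, c * v = v * c) ∧ ∑ i ∈ s, i.1 * i.2 = 1 ∧ ∑ i ∈ s, i.2 * i.1 = 1 ∧
      (∀ v, ∑ i ∈ s, τ (i.2 * v) • i.1 = v * c) ∧ (∀ v, ∑ i ∈ s, τ (i.1 * v) • i.2 = v * c) := by
  obtain ⟨s, hs⟩ := TensorProduct.exists_finset f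
  set c := ∑ i ∈ s, τ i.2 • i.1 with hc
  have hcomm : ∀ v, c * v = v * c := fun v => by
    rw [hc, ← hf.sum_smul_casimir τ hs, ← hf.sum_smul_casimir' τ hs]
    simp only [hτ]
  have hinj : Function.Injective (LinearMap.mulRight k c) := by
    rw [← LinearMap.ker_eq_bot, LinearMap.ker_eq_bot']
    intro r hr
    rw [LinearMap.mulRight_apply] at hr
    -- If `rc = 0`, then for each functional `φ` the element `∑ φ(p) q r` pairs with `v` under `τ`
    -- to `φ(rvc) = 0`, so it vanishes. Thus `∑ p ⊗ qr = 0`, and multiplying the legs gives `r = 0`.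
    have h0 : TensorProduct.map LinearMap.id (LinearMap.mulRight k r) f = 0 := by
      refine TensorProduct.ext_functionals fun φ ψ => ?_
      have hq : ∑ i ∈ s, φ i.1 • (i.2 * r) = 0 := by
        refine hnd _ fun v => ?_
        have h := congrArg φ (hf.sum_smul_casimir τ hs (r * v))
        rw [← hc, mul_assoc, ← hcomm, ← mul_assoc, hr, zero_mul, map_zero, map_sum] at h
        rw [← h, Finset.sum_mul, map_sum]
        refine Finset.sum_congr rfl fun i _ => ?_
        rw [smul_mul_assoc, map_smul, map_smul, smul_eq_mul, smul_eq_mul, mul_comm, mul_assoc]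
      have := congrArg ψ hq
      rw [hs]
      simpa using this
    have := congrArg (LinearMap.mul' k R) h0
    rw [hs] at this
    simp only [map_sum, TensorProduct.map_tmul, LinearMap.mul'_apply, LinearMap.id_apply,
      LinearMap.mulRight_apply, ← mul_assoc, map_zero] at this
    rwa [← Finset.sum_mul, hf.sum_mul_eq_one hs, one_mul] at this
  -- The identity `rc = ∑ τ(qr) p` puts the image of the injective map `r ↦ rc` in the span of the
  -- finitely many `p`.
  have hfd : FiniteDimensional k R := by
    classical
    let P := Submodule.span k ((s.image Prod.fst : Finset R) : Set R)
    have hmem : ∀ r, LinearMap.mulRight k c r ∈ P := by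
      intro r
      rw [LinearMap.mulRight_apply, hc, ← hf.sum_smul_casimir τ hs]
      exact Submodule.sum_mem _ fun i hi => Submodule.smul_mem _ _
        (Submodule.subset_span (Finset.mem_coe.2 (Finset.mem_image_of_mem _ hi)))
    have : FiniteDimensional k P := FiniteDimensional.span_finset k _
    exact FiniteDimensional.of_injective ((LinearMap.mulRight k c).codRestrict P hmem)
      (fun x y h => hinj (congrArg Subtype.val h))
  refine ⟨hfd, ?_⟩
  obtain ⟨w, hw⟩ := LinearMap.surjective_of_injective hinj 1
  rw [LinearMap.mulRight_apply] at hw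
  refine ⟨w, c, s, ?_, hw, by rw [hcomm, hw], hcomm, hf.sum_mul_eq_one hs,
    hf.sum_mul_eq_one' hs, fun v => hf.sum_smul_casimir τ hs v, fun v => ?_⟩
  · rw [hs]
    simp [hc]
  · have := hf.sum_smul_symm (τ ∘ₗ LinearMap.mulRight k v) hs
    simp only [LinearMap.comp_apply, LinearMap.mulRight_apply] at this
    rw [this, hf.sum_smul_casimir τ hs]

end Trace

end IsSymmSeparabilityElement

end SymmSep

/-! ### Weak Hopf algebras from algebras of endomorphisms -/

/-- An algebra `B` of endomorphisms of a symmetric algebra `A`, stable under adjoints,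
containing the left and right multiplications by a Kanzaki separable subalgebra `V` and such
that every `b ∈ B` satisfies `b(xy) = b₍₁₎(x) b₍₂₎(y)` for some `b₍₁₎ ⊗ b₍₂₎ ∈ B ⊗ B`. -/
structure GaloisSystem (k A B V : Type*) [Field k] [Ring A] [Algebra k A] [Ring B] [Algebra k B]
    [Ring V] [Algebra k V] where
  ι : V →ₐ[k] A
  φ : B →ₐ[k] Module.End k A
  L : V →ₗ[k] B
  R : V →ₗ[k] B
  φ_L : ∀ v x, φ (L v) x = ι v * x
  φ_R : ∀ v x, φ (R v) x = x * ι v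
  stable : ∀ b v, ∃ v', φ b (ι v) = ι v'
  τ : A →ₗ[k] k
  τ_comm : ∀ x y, τ (x * y) = τ (y * x)
  τ_nondeg : ∀ x, (∀ y, τ (y * x) = 0) → x = 0
  star : B →ₗ[k] B
  τ_star : ∀ b x y, τ (φ (star b) x * y) = τ (x * φ b y)
  ε : A →ₗ[k] k
  w : V
  c : V
  w_mul_c : w * c = 1
  c_mul_w : c * w = 1
  c_central : ∀ v, c * v = v * c
  ε_ι : ∀ v, ε (ι v) = τ (ι v * ι w)
  ε_mul : ∀ y, ∃ v, ∀ x, ε (x * y) = ε (x * ι v)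
  s : Finset (V × V)
  sum_mul : ∑ i ∈ s, i.1 * i.2 = 1
  sum_mul' : ∑ i ∈ s, i.2 * i.1 = 1
  sum_ε : ∀ v, ∑ i ∈ s, ε (ι (i.2 * v)) • i.1 = v
  sum_ε' : ∀ v, ∑ i ∈ s, ε (ι (v * i.1)) • i.2 = v
  perf : (φ.toLinearMap.compr₂ ε).flip.IsPerfPair
  galois : ∀ b, ∃ t : B ⊗[k] B, ∀ x y,
    LinearMap.mul' k A (TensorProduct.map (φ.toLinearMap.flip x) (φ.toLinearMap.flip y) t) =
      φ b (x * y)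

namespace GaloisSystem

variable {k A B V : Type*} [Field k] [Ring A] [Algebra k A] [Ring B] [Algebra k B]
    [Ring V] [Algebra k V] (D : GaloisSystem k A B V)

/-- The pairing `(a, b) ↦ ε(b(a))`. -/
def pair : A →ₗ[k] B →ₗ[k] k := (D.φ.toLinearMap.compr₂ D.ε).flip

@[simp] theorem pair_apply (a : A) (b : B) : D.pair a b = D.ε (D.φ b a) := rfl

/-- The map `b ⊗ b' ↦ b(x) b'(y)`. -/
def ev₂ (x y : A) : B ⊗[k] B →ₗ[k] A :=
  LinearMap.mul' k A ∘ₗ TensorProduct.map (D.φ.toLinearMap.flip x) (D.φ.toLinearMap.flip y)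

@[simp] theorem ev₂_tmul (x y : A) (b b' : B) : D.ev₂ x y (b ⊗ₜ b') = D.φ b x * D.φ b' y := rfl

theorem φ_injective : Function.Injective D.φ := by
  intro b b' h
  apply D.perf.bijective_right.1
  ext a
  change D.ε (D.φ b a) = D.ε (D.φ b' a)
  rw [h]

theorem ext_φ {b b' : B} (h : ∀ x, D.φ b x = D.φ b' x) : b = b' :=
  D.φ_injective (LinearMap.ext h)

theorem ext_τ {x x' : A} (h : ∀ y, D.τ (y * x) = D.τ (y * x')) : x = x' := by
  rw [← sub_eq_zero]
  exact D.τ_nondeg _ fun y => by rw [mul_sub, map_sub, h, sub_self]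

theorem τ_star' (b : B) (x y : A) : D.τ (x * D.φ (D.star b) y) = D.τ (D.φ b x * y) := by
  rw [D.τ_comm, D.τ_star, D.τ_comm]

theorem star_star (b : B) : D.star (D.star b) = b :=
  D.ext_φ fun x => D.ext_τ fun y => by rw [D.τ_star', D.τ_star]

theorem star_mul (b b' : B) : D.star (b * b') = D.star b' * D.star b :=
  D.ext_φ fun x => D.ext_τ fun y => by
    simp only [map_mul, Module.End.mul_apply, D.τ_star']

theorem star_L (v : V) : D.star (D.L v) = D.R v :=
  D.ext_φ fun x => D.ext_τ fun y => by
    rw [D.τ_star', D.φ_L, D.φ_R, mul_assoc, D.τ_comm, mul_assoc]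

theorem star_R (v : V) : D.star (D.R v) = D.L v := by rw [← star_L, star_star]

theorem L_one : D.L 1 = 1 := D.ext_φ fun x => by simp [D.φ_L]

theorem R_one : D.R 1 = 1 := D.ext_φ fun x => by simp [D.φ_R]

theorem L_mul (v v' : V) : D.L v * D.L v' = D.L (v * v') :=
  D.ext_φ fun x => by simp [D.φ_L, mul_assoc]

theorem R_mul (v v' : V) : D.R v * D.R v' = D.R (v' * v) :=
  D.ext_φ fun x => by simp [D.φ_R, mul_assoc]

theorem L_mul_R (v v' : V) : D.L v * D.R v' = D.R v' * D.L v :=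
  D.ext_φ fun x => by simp [D.φ_R, D.φ_L, mul_assoc]

/-- The element `Δ(1)`. -/
def Δ₁ : B ⊗[k] B := ∑ i ∈ D.s, D.R i.1 ⊗ₜ[k] D.L i.2

/-- By `ε_mul` the factor `y` may be replaced by some `v ∈ V`, and `v = ∑ ε(qv) p`. -/
theorem sum_ε_mul (x y : A) : ∑ i ∈ D.s, D.ε (x * D.ι i.1) * D.ε (D.ι i.2 * y) = D.ε (x * y) := by
  obtain ⟨v, hv⟩ := D.ε_mul y
  rw [hv x]
  conv_rhs => rw [← D.sum_ε v]
  simp only [map_sum, map_smul, Finset.mul_sum, mul_smul_comm, smul_eq_mul]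
  exact Finset.sum_congr rfl fun i _ => by rw [hv, map_mul D.ι, mul_comm]

/-- Multiplication by `Δ(1)` removes the ambiguity of `t`: the product depends only on the bilinear
map `(x, y) ↦ ∑ t₁(x) t₂(y)`. -/
theorem pair_Δ₁_mul (a a' : A) (t : B ⊗[k] B) :
    LinearMap.mul' k k (TensorProduct.map (D.pair a) (D.pair a') (D.Δ₁ * t)) =
      D.ε (D.ev₂ a a' t) := by
  induction t with
  | zero => simp
  | add x y hx hy => simp only [mul_add, map_add, hx, hy]
  | tmul b b' =>
    simp only [Δ₁, Finset.sum_mul, map_sum, Algebra.TensorProduct.tmul_mul_tmul,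
      TensorProduct.map_tmul, LinearMap.mul'_apply, pair_apply, map_mul, Module.End.mul_apply,
      D.φ_R, D.φ_L, ev₂_tmul, D.sum_ε_mul]

theorem tensor_ext {s t : B ⊗[k] B} (h : ∀ a a' : A,
      LinearMap.mul' k k (TensorProduct.map (D.pair a) (D.pair a') s) =
      LinearMap.mul' k k (TensorProduct.map (D.pair a) (D.pair a') t)) : s = t :=
  LinearMap.IsPerfPair.tensor_ext D.pair D.perf h

theorem Δ₁_mul_eq {s t : B ⊗[k] B} (h : ∀ x y, D.ev₂ x y s = D.ev₂ x y t) :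
    D.Δ₁ * s = D.Δ₁ * t :=
  D.tensor_ext fun a a' => by rw [pair_Δ₁_mul, pair_Δ₁_mul, h]

/-- The factor `Δ(1)` inserts `∑ pq = 1` between the two values. -/
theorem ev₂_Δ₁_mul (x y : A) (t : B ⊗[k] B) : D.ev₂ x y (D.Δ₁ * t) = D.ev₂ x y t := by
  induction t with
  | zero => simp
  | add x y hx hy => simp only [mul_add, map_add, hx, hy]
  | tmul b b' =>
    have h : ∀ i : V × V, D.φ b x * D.ι i.1 * (D.ι i.2 * D.φ b' y) =
        D.φ b x * D.ι (i.1 * i.2) * D.φ b' y := fun i => by simp only [map_mul, mul_assoc]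
    simp only [Δ₁, Finset.sum_mul, map_sum, Algebra.TensorProduct.tmul_mul_tmul, ev₂_tmul,
      map_mul, Module.End.mul_apply, D.φ_R, D.φ_L]
    simp only [h]
    rw [← Finset.sum_mul, ← Finset.mul_sum, ← map_sum, D.sum_mul, map_one, mul_one]

/-- The coalgebra structures on `B` dual to the multiplication of `A`. -/
structure IsDual (W : Coalgebra k B) : Prop where
  comul : ∀ (a a' : A) (b : B), LinearMap.mul' k k (TensorProduct.map (D.pair a) (D.pair a')
    (W.comul b)) = D.pair (a * a') b
  counit : ∀ b, W.counit b = D.ε (D.φ b 1)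

/-- The antipode `S(b) = w⁻¹ b^* w`, where `w` and `w⁻¹` act by right multiplications. -/
def S : B →ₗ[k] B := LinearMap.mulRight k (D.R D.w) ∘ₗ LinearMap.mulLeft k (D.R D.c) ∘ₗ D.star

theorem S_apply (b : B) : D.S b = D.R D.c * D.star b * D.R D.w := rfl

theorem S_mul_L (b : B) (v : V) : D.S (b * D.L v) = D.R v * D.S b := by
  rw [S_apply, S_apply, D.star_mul, D.star_L, ← mul_assoc, D.R_mul, ← D.c_central, ← D.R_mul]
  simp only [mul_assoc]

theorem S_R_mul (b : B) (v : V) : D.S (D.R v * b) = D.S b * D.L v := by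
  simp only [S_apply, D.star_mul, D.star_R, mul_assoc, D.L_mul_R]

theorem star_S (b : B) : D.star (D.S b) = D.L D.w * b * D.L D.c := by
  rw [S_apply, D.star_mul, D.star_mul, D.star_R, D.star_R, D.star_star, mul_assoc]

/-! ### The dual comultiplication on `B` and the weak Hopf axioms. -/

section Coalgebra

variable [W : Coalgebra k B]

open Coalgebra CoalgebraStruct

variable {D}

/-- This computes `Δ(b)` from any product rule for the operator `b`, and is the source of all later
formulas for `Δ`. -/
theorem comul_eq (hW : D.IsDual W) {b : B} {t : B ⊗[k] B}
    (h : ∀ x y, D.ev₂ x y t = D.φ b (x * y)) : comul (R := k) b = D.Δ₁ * t :=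
  D.tensor_ext fun a a' => by rw [D.pair_Δ₁_mul, hW.comul, h]; rfl

theorem ev₂_comul (hW : D.IsDual W) (b : B) (x y : A) :
    D.ev₂ x y (comul (R := k) b) = D.φ b (x * y) := by
  obtain ⟨t, ht⟩ := D.galois b
  rw [comul_eq hW ht, D.ev₂_Δ₁_mul]
  exact ht x y

theorem comul_fixed (hW : D.IsDual W) (b : B) :
    D.Δ₁ * comul (R := k) b = comul (R := k) b :=
  (comul_eq hW (ev₂_comul hW b)).symm

theorem comul_one (hW : D.IsDual W) : comul (R := k) (1 : B) = D.Δ₁ := by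
  rw [comul_eq hW (t := 1) (fun x y => by simp [Algebra.TensorProduct.one_def]), mul_one]

theorem ev₂_comul_mul (hW : D.IsDual W) (b : B) (t : B ⊗[k] B) (x y : A) :
    D.ev₂ x y (comul (R := k) b * t) = D.φ b (D.ev₂ x y t) := by
  induction t with
  | zero => simp
  | add x y hx hy => simp only [mul_add, map_add, hx, hy]
  | tmul c c' =>
    rw [ev₂_tmul, ← ev₂_comul hW]
    generalize comul (R := k) b = s
    induction s with
    | zero => simp
    | add x y hx hy => simp only [add_mul, map_add, hx, hy]
    | tmul d d' => simp

/-- The tensor `Δ(b)Δ(b')` implements `bb'` on products and already absorbs `Δ(1)` on the left. -/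
theorem comul_mul (hW : D.IsDual W) (b b' : B) :
    comul (R := k) (b * b') = comul b * comul b' := by
  rw [comul_eq hW (t := comul b * comul b'), ← mul_assoc, comul_fixed hW]
  intro x y
  rw [ev₂_comul_mul hW, ev₂_comul hW, map_mul D.φ, Module.End.mul_apply]

theorem comul_R (hW : D.IsDual W) (v : V) :
    comul (R := k) (D.R v) = D.Δ₁ * ((1 : B) ⊗ₜ[k] D.R v) :=
  comul_eq hW fun x y => by simp [D.φ_R, mul_assoc]

/-- Since `(xy)v = x(yv)`, right multiplication acts on the second factor only; it moves past `Δ(1)`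
because left and right multiplications commute. -/
theorem comul_R_mul (hW : D.IsDual W) (v : V) (b : B) :
    comul (R := k) (D.R v * b) = ((1 : B) ⊗ₜ[k] D.R v) * comul b := by
  have h : D.Δ₁ * ((1 : B) ⊗ₜ[k] D.R v) = ((1 : B) ⊗ₜ[k] D.R v) * D.Δ₁ := by
    simp [Δ₁, Finset.sum_mul, Finset.mul_sum, D.L_mul_R]
  rw [comul_mul hW, comul_R hW, h, mul_assoc, comul_fixed hW]

/-- `Δ(b)` is a finite sum of elements `R(p) c ⊗ L(q) c'`, where `p ⊗ q` runs through the
separability element. -/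
theorem exists_comul_eq_sum (hW : D.IsDual W) (b : B) : ∃ t : Finset (B × B),
    comul (R := k) b = ∑ j ∈ t, ∑ i ∈ D.s, (D.R i.1 * j.1) ⊗ₜ[k] (D.L i.2 * j.2) ∧
    ∀ x y, ∑ j ∈ t, D.φ j.1 x * D.φ j.2 y = D.φ b (x * y) := by
  obtain ⟨t, ht⟩ := TensorProduct.exists_finset (comul (R := k) b)
  refine ⟨t, ?_, fun x y => ?_⟩
  · rw [← comul_fixed hW, ht]
    simp only [Δ₁, Finset.mul_sum, Finset.sum_mul, Algebra.TensorProduct.tmul_mul_tmul]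
  · rw [← ev₂_comul hW, ht, map_sum]
    rfl

/-- `ε(b₍₁₎(v)) b₍₂₎ = b L(v)`. -/
theorem counit_left_act (hW : D.IsDual W) (b : B) (v : V) :
    TensorProduct.lid k B (TensorProduct.map (D.pair (D.ι v)) LinearMap.id
      (comul (R := k) b)) = b * D.L v := by
  obtain ⟨t, ht, ht'⟩ := exists_comul_eq_sum hW b
  refine D.ext_φ fun y => ?_
  rw [ht, map_mul, Module.End.mul_apply, D.φ_L, ← ht']
  simp only [map_sum, LinearMap.sum_apply]
  refine Finset.sum_congr rfl fun j _ => ?_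
  -- The value of `j.1` at `v` stays in `V`, so it is recovered from its `ε`-coefficients by
  -- `sum_ε'`.
  obtain ⟨v', hv'⟩ := D.stable j.1 v
  conv_rhs => rw [hv', ← D.sum_ε' v']
  simp [D.φ_R, D.φ_L, hv', Finset.sum_mul]

/-- `b₍₁₎ ε(b₍₂₎(v)) = b R(v)`. -/
theorem counit_right_act (hW : D.IsDual W) (b : B) (v : V) :
    TensorProduct.rid k B (TensorProduct.map LinearMap.id (D.pair (D.ι v))
      (comul (R := k) b)) = b * D.R v := by
  obtain ⟨t, ht, ht'⟩ := exists_comul_eq_sum hW b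
  refine D.ext_φ fun y => ?_
  rw [ht, map_mul, Module.End.mul_apply, D.φ_R, ← ht']
  simp only [map_sum, LinearMap.sum_apply]
  refine Finset.sum_congr rfl fun j _ => ?_
  obtain ⟨v', hv'⟩ := D.stable j.2 v
  conv_rhs => rw [hv', ← D.sum_ε v']
  simp [D.φ_R, D.φ_L, hv', Finset.mul_sum]

/-- Only `v = f(1) ∈ V` matters on the right. Expand `g(1 · v)` by the product rule, then the second
factor `g₍₂₎(v) ∈ V` in the dual bases of `ε`. The mirrored axiom uses `g(v · 1)`. -/
theorem counit_mul_left (hW : D.IsDual W) (h g f : B) : counit (R := k) (h * g * f) =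
    LinearMap.mul' k k (TensorProduct.map (counit ∘ₗ LinearMap.mulLeft k h)
      (counit ∘ₗ LinearMap.mulRight k f) (comul g)) := by
  obtain ⟨t, ht, ht'⟩ := exists_comul_eq_sum hW g
  obtain ⟨v, hv⟩ := D.stable f 1
  rw [map_one] at hv
  rw [ht, hW.counit]
  simp only [map_mul, Module.End.mul_apply, map_sum, TensorProduct.map_tmul, LinearMap.comp_apply,
    LinearMap.mulLeft_apply, LinearMap.mulRight_apply, LinearMap.mul'_apply, hW.counit, D.φ_R,
    D.φ_L, hv]
  rw [← one_mul (D.ι v), ← ht', map_sum, map_sum, one_mul]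
  refine Finset.sum_congr rfl fun j _ => ?_
  obtain ⟨v', hv'⟩ := D.stable j.2 v
  conv_lhs => rw [hv', ← D.sum_ε v']
  simp [hv', Finset.mul_sum, mul_comm]

theorem counit_mul_right (hW : D.IsDual W) (h g f : B) : counit (R := k) (h * g * f) =
    LinearMap.mul' k k (TensorProduct.map (counit ∘ₗ LinearMap.mulRight k f)
      (counit ∘ₗ LinearMap.mulLeft k h) (comul g)) := by
  obtain ⟨t, ht, ht'⟩ := exists_comul_eq_sum hW g
  obtain ⟨v, hv⟩ := D.stable f 1
  rw [map_one] at hv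
  rw [ht, hW.counit]
  simp only [map_mul, Module.End.mul_apply, map_sum, TensorProduct.map_tmul, LinearMap.comp_apply,
    LinearMap.mulLeft_apply, LinearMap.mulRight_apply, LinearMap.mul'_apply, hW.counit, D.φ_R,
    D.φ_L, hv]
  rw [← mul_one (D.ι v), ← ht', map_sum, map_sum, mul_one]
  refine Finset.sum_congr rfl fun j _ => ?_
  obtain ⟨v', hv'⟩ := D.stable j.1 v
  conv_lhs => rw [hv', ← D.sum_ε' v']
  simp [hv', Finset.sum_mul]

theorem comul_one_left (hW : D.IsDual W) : LinearMap.rTensor B comul (comul (R := k) (1 : B)) =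
    ((comul 1) ⊗ₜ[k] (1 : B)) *
      (TensorProduct.assoc k B B B).symm ((1 : B) ⊗ₜ[k] (comul 1)) := by
  rw [comul_one hW]
  conv_lhs => rw [Δ₁]
  conv_rhs => rw [Δ₁]
  simp only [map_sum, LinearMap.rTensor_tmul, comul_R hW, TensorProduct.tmul_sum, Finset.mul_sum,
    TensorProduct.assoc_symm_tmul, Algebra.TensorProduct.tmul_mul_tmul, one_mul]
  rfl

theorem comul_one_right (hW : D.IsDual W) : LinearMap.rTensor B comul (comul (R := k) (1 : B)) =
      (TensorProduct.assoc k B B B).symm ((1 : B) ⊗ₜ[k] (comul 1)) *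
    ((comul 1) ⊗ₜ[k] (1 : B)) := by
  rw [comul_one hW]
  conv_lhs => rw [Δ₁]
  conv_rhs => enter [1]; rw [Δ₁]
  simp only [map_sum, LinearMap.rTensor_tmul, TensorProduct.tmul_sum, Finset.sum_mul,
    TensorProduct.assoc_symm_tmul, Algebra.TensorProduct.tmul_mul_tmul, mul_one]
  refine Finset.sum_congr rfl fun i _ => ?_
  rw [← comul_one hW, ← comul_R_mul hW, mul_one]

/-- The source counital map `ε_s`. -/
theorem source_counit (hW : D.IsDual W) (b : B) :
    TensorProduct.rid k B (LinearMap.lTensor B counit (((1 : B) ⊗ₜ[k] b) * comul 1)) =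
      ∑ i ∈ D.s, D.ε (D.φ b (D.ι i.2)) • D.R i.1 := by
  rw [comul_one hW]
  simp [Δ₁, Finset.mul_sum, hW.counit, D.φ_L]

theorem target_counit (hW : D.IsDual W) {b : B} {v : V} (hv : D.φ b 1 = D.ι v) :
    TensorProduct.lid k B (LinearMap.rTensor B counit (comul 1 * (b ⊗ₜ[k] (1 : B)))) =
      D.L v := by
  rw [comul_one hW]
  conv_rhs => rw [← D.sum_ε' v]
  simp [Δ₁, Finset.sum_mul, hW.counit, D.φ_R, hv]

/-- Applied to `y` and tested against `x` under `τ`, both sides equal `τ(b(cxy) w)`. For the left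
side the adjoint in `S(b₍₁₎)` moves `b₍₁₎` onto `cx`, after which the product rule recombines the
factors. -/
theorem mul_antipode_left (hW : D.IsDual W) (b : B) :
    LinearMap.mul' k B (TensorProduct.map D.S LinearMap.id (comul b)) =
      TensorProduct.rid k B (LinearMap.lTensor B counit (((1 : B) ⊗ₜ[k] b) * comul 1)) := by
  rw [source_counit hW]
  refine D.ext_φ fun y => D.ext_τ fun x => ?_
  trans D.τ (D.φ b (D.ι D.c * x * y) * D.ι D.w)
  · obtain ⟨t, ht⟩ := TensorProduct.exists_finset (comul (R := k) b)
    have ht' : ∀ x y, ∑ j ∈ t, D.φ j.1 x * D.φ j.2 y = D.φ b (x * y) := fun x y => by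
      rw [← ev₂_comul hW, ht, map_sum]; rfl
    rw [← ht', ht, Finset.sum_mul]
    simp only [map_sum, LinearMap.sum_apply, Finset.mul_sum, TensorProduct.map_tmul,
      LinearMap.mul'_apply, LinearMap.id_apply, map_mul, Module.End.mul_apply, S_apply, D.φ_R]
    refine Finset.sum_congr rfl fun j _ => ?_
    rw [← mul_assoc, D.τ_comm, ← mul_assoc, D.τ_star', mul_assoc]
  -- With `v = b^*(w)`, adjunction gives `ε(b(v')) = ε(v'vc)`, so the dual bases sum the right side
  -- to `y v c`.
  · obtain ⟨v, hv⟩ := D.stable (D.star b) D.w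
    have h : ∀ v', D.ε (D.φ b (D.ι v')) = D.ε (D.ι (v' * v * D.c)) := by
      intro v'
      obtain ⟨v'', h''⟩ := D.stable b v'
      rw [h'', D.ε_ι, ← h'', D.ε_ι, ← map_mul, mul_assoc, D.c_mul_w, mul_one, map_mul D.ι, ← hv,
        D.τ_star']
    simp only [h, map_sum, map_smul, LinearMap.sum_apply, LinearMap.smul_apply, D.φ_R]
    have h2 := D.sum_ε (v * D.c)
    simp only [← mul_assoc] at h2
    have h3 : ∑ i ∈ D.s, D.ε (D.ι (i.2 * v * D.c)) • (y * D.ι i.1) = y * D.ι (v * D.c) := by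
      conv_rhs => rw [← h2]
      simp only [map_sum, map_smul, Finset.mul_sum, mul_smul_comm]
    rw [h3, map_mul D.ι, ← hv, ← D.τ_star']
    simp only [mul_assoc]
    rw [D.τ_comm]
    simp only [mul_assoc]

/-- Replacing `S(b₍₁₎)b₍₂₎` by the source counit leaves `∑ R(p) S(b L(q)) = ∑ R(p) R(q) S(b)`, and
`∑ qp = 1`. -/
theorem antipode_mul_antipode (hW : D.IsDual W) (b : B) :
    LinearMap.mul' k B (TensorProduct.map
      (LinearMap.mul' k B ∘ₗ TensorProduct.map D.S LinearMap.id) D.S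
      (LinearMap.rTensor B comul (comul b))) = D.S b := by
  have h1 : ∀ t : B ⊗[k] B, LinearMap.mul' k B (TensorProduct.map
      (LinearMap.mul' k B ∘ₗ TensorProduct.map D.S LinearMap.id) D.S
      (LinearMap.rTensor B comul t)) = ∑ i ∈ D.s, D.R i.1 * D.S (TensorProduct.lid k B
        (TensorProduct.map (D.pair (D.ι i.2)) LinearMap.id t)) := by
    intro t
    induction t with
    | zero => simp
    | add x y hx hy => simp only [map_add, hx, hy, mul_add, Finset.sum_add_distrib]
    | tmul x y =>
      simp only [LinearMap.rTensor_tmul, TensorProduct.map_tmul, LinearMap.comp_apply,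
        mul_antipode_left hW, source_counit hW, LinearMap.mul'_apply, Finset.sum_mul, pair_apply,
        LinearMap.id_apply, TensorProduct.lid_tmul, map_smul, smul_mul_assoc, mul_smul_comm]
  simp only [h1, counit_left_act hW, S_mul_L, ← mul_assoc, D.R_mul]
  rw [← Finset.sum_mul, ← map_sum, D.sum_mul', D.R_one, one_mul]

/-- `b₍₁₎ S(b₍₂₎) b₍₃₎ = b`. -/
theorem mul_antipode_mul (hW : D.IsDual W) (b : B) :
    LinearMap.mul' k B (TensorProduct.map
      (LinearMap.mul' k B ∘ₗ TensorProduct.map LinearMap.id D.S ∘ₗ comul) LinearMap.id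
      (comul b)) = b := by
  have h0 : ∀ s : (B ⊗[k] B) ⊗[k] B, LinearMap.mul' k B (TensorProduct.map
      (LinearMap.mul' k B ∘ₗ TensorProduct.map LinearMap.id D.S) LinearMap.id s) =
      LinearMap.mul' k B (TensorProduct.map LinearMap.id
        (LinearMap.mul' k B ∘ₗ TensorProduct.map D.S LinearMap.id)
        (TensorProduct.assoc k B B B s)) := by
    intro s
    refine LinearMap.congr_fun (f := LinearMap.mul' k B ∘ₗ TensorProduct.map
      (LinearMap.mul' k B ∘ₗ TensorProduct.map LinearMap.id D.S) LinearMap.id)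
      (g := LinearMap.mul' k B ∘ₗ TensorProduct.map LinearMap.id
        (LinearMap.mul' k B ∘ₗ TensorProduct.map D.S LinearMap.id) ∘ₗ
        (TensorProduct.assoc k B B B).toLinearMap) ?_ s
    ext x y z
    simp [mul_assoc]
  have h1 : ∀ t : B ⊗[k] B, LinearMap.mul' k B (TensorProduct.map LinearMap.id
      (LinearMap.mul' k B ∘ₗ TensorProduct.map D.S LinearMap.id)
      (LinearMap.lTensor B comul t)) = ∑ i ∈ D.s, (TensorProduct.rid k B
        (TensorProduct.map LinearMap.id (D.pair (D.ι i.2)) t)) * D.R i.1 := by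
    intro t
    induction t with
    | zero => simp
    | add x y hx hy => simp only [map_add, hx, hy, add_mul, Finset.sum_add_distrib]
    | tmul x y =>
      simp only [LinearMap.lTensor_tmul, TensorProduct.map_tmul, LinearMap.comp_apply,
        mul_antipode_left hW, source_counit hW, LinearMap.mul'_apply, Finset.mul_sum, pair_apply,
        LinearMap.id_apply, TensorProduct.rid_tmul, smul_mul_assoc, mul_smul_comm]
  have h2 : ∀ t : B ⊗[k] B, TensorProduct.map
      (LinearMap.mul' k B ∘ₗ TensorProduct.map LinearMap.id D.S ∘ₗ comul) LinearMap.id t =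
      TensorProduct.map (LinearMap.mul' k B ∘ₗ TensorProduct.map LinearMap.id D.S)
        LinearMap.id (LinearMap.rTensor B comul t) := by
    intro t
    induction t with
    | zero => simp
    | add x y hx hy => simp only [map_add, hx, hy]
    | tmul x y => simp
  rw [h2, h0, Coalgebra.coassoc_apply, h1]
  simp only [counit_right_act hW, mul_assoc, D.R_mul]
  rw [← Finset.mul_sum, ← map_sum, D.sum_mul, D.R_one, mul_one]

/-- Write `Δ(b^*) = ∑ s ⊗ t`. Taking adjoints in the product rule for `b^*` gives `∑ t^*(z s(x)) =
b(z) x`. Hence `∑ t^* s = L(b(1))` and `∑ Δ(t^*)(1 ⊗ s) = Δ(1)(b ⊗ 1)`. Apply `d ⊗ d' ↦ d₍₁₎ S(d₍₂₎)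
d'` to the last identity: `mul_antipode_mul` turns the left side into `∑ t^* s`, while `∑ pq = 1`
turns the right side into `b₍₁₎ S(b₍₂₎)`. -/
theorem mul_antipode_right (hW : D.IsDual W) (b : B) :
    LinearMap.mul' k B (TensorProduct.map LinearMap.id D.S (comul b)) =
      TensorProduct.lid k B (LinearMap.rTensor B counit (comul 1 * (b ⊗ₜ[k] (1 : B)))) := by
  obtain ⟨v, hv⟩ := D.stable b 1
  rw [map_one] at hv
  rw [target_counit hW hv]
  obtain ⟨t, ht⟩ := TensorProduct.exists_finset (comul (R := k) (D.star b))
  have ht' : ∀ x y, ∑ j ∈ t, D.φ j.1 x * D.φ j.2 y = D.φ (D.star b) (x * y) := fun x y => by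
    rw [← ev₂_comul hW, ht, map_sum]; rfl
  have hb : ∀ x z, ∑ j ∈ t, D.φ (D.star j.2) (z * D.φ j.1 x) = D.φ b z * x := by
    intro x z
    refine D.ext_τ fun y => ?_
    rw [← mul_assoc, D.τ_comm _ x, ← mul_assoc, D.τ_comm _ (D.φ b z), ← D.τ_star',
      ← ht']
    simp only [Finset.mul_sum, map_sum]
    refine Finset.sum_congr rfl fun j _ => ?_
    rw [D.τ_star', D.τ_comm, mul_assoc]
  have hL : ∑ j ∈ t, D.star j.2 * j.1 = D.L v := by
    refine D.ext_φ fun x => ?_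
    have := hb x 1
    simp only [one_mul] at this
    simpa [D.φ_L, hv] using this
  have hc : ∑ j ∈ t, comul (R := k) (D.star j.2) * ((1 : B) ⊗ₜ[k] j.1) =
      D.Δ₁ * (b ⊗ₜ[k] (1 : B)) := by
    have h : ∑ j ∈ t, comul (R := k) (D.star j.2) * ((1 : B) ⊗ₜ[k] j.1) =
        D.Δ₁ * ∑ j ∈ t, comul (R := k) (D.star j.2) * ((1 : B) ⊗ₜ[k] j.1) := by
      simp only [Finset.mul_sum, ← mul_assoc, comul_fixed hW]
    rw [h]
    refine D.Δ₁_mul_eq fun x y => ?_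
    simp only [map_sum, ev₂_comul_mul hW, ev₂_tmul, map_one, Module.End.one_apply, hb]
  let Q : B →ₗ[k] B := LinearMap.mul' k B ∘ₗ TensorProduct.map LinearMap.id D.S ∘ₗ comul
  have hQR : ∀ (v : V) (b : B), Q (D.R v * b) = Q b * D.L v := by
    intro v b
    simp only [Q, LinearMap.comp_apply, comul_R_mul hW]
    generalize comul (R := k) b = s
    induction s with
    | zero => simp
    | add x y hx hy => simp only [map_add, mul_add, add_mul, hx, hy]
    | tmul x y => simp [D.S_R_mul, mul_assoc]
  have hQ : ∀ (s : B ⊗[k] B) (d : B), LinearMap.mul' k B (TensorProduct.map Q LinearMap.id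
      (s * ((1 : B) ⊗ₜ[k] d))) = LinearMap.mul' k B (TensorProduct.map Q LinearMap.id s) * d := by
    intro s d
    induction s with
    | zero => simp
    | add x y hx hy => simp only [map_add, add_mul, hx, hy]
    | tmul x y => simp [mul_assoc]
  have h1 := congrArg (fun s => LinearMap.mul' k B (TensorProduct.map Q LinearMap.id s)) hc
  simp only [map_sum, hQ, Q, mul_antipode_mul hW] at h1
  rw [hL] at h1
  rw [h1]
  change Q b = LinearMap.mul' k B (TensorProduct.map Q LinearMap.id _)
  simp only [Δ₁, Finset.sum_mul, Algebra.TensorProduct.tmul_mul_tmul, map_sum,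
    TensorProduct.map_tmul, hQR, LinearMap.id_apply, mul_one, LinearMap.mul'_apply, mul_assoc,
    D.L_mul]
  rw [← Finset.mul_sum, ← map_sum, D.sum_mul, D.L_one, mul_one]

end Coalgebra

/-- The weak Hopf algebra structure on `B` dual to the algebra `A`. -/
theorem exists_weakHopfAlgebra [FiniteDimensional k B] : ∃ W : WeakHopfAlgebra k B,
    (∀ (a a' : A) (b : B), LinearMap.mul' k k (TensorProduct.map (D.pair a) (D.pair a')
      (W.comul b)) = D.pair (a * a') b) ∧
    (∀ b, W.counit b = D.pair 1 b) ∧ W.antipode = D.S ∧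
    (∀ b x y, LinearMap.mul' k A (TensorProduct.map (D.φ.toLinearMap.flip x)
      (D.φ.toLinearMap.flip y) (W.comul b)) = D.φ b (x * y)) ∧
    (∀ b v, D.φ b 1 = D.ι v → W.targetCounit b = D.L v) := by
  obtain ⟨W, hW, hW'⟩ := exists_coalgebra_of_isPerfPair D.pair D.perf
  have h : D.IsDual W := ⟨hW, hW'⟩
  exact ⟨{ W with
      comul_mul := comul_mul h
      counit_mul_left := counit_mul_left h
      counit_mul_right := counit_mul_right h
      comul_one_left := comul_one_left h
      comul_one_right := comul_one_right h
      antipode := D.S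
      mul_antipode_right := mul_antipode_right h
      mul_antipode_left := mul_antipode_left h
      antipode_mul_antipode := antipode_mul_antipode h },
    hW, hW', rfl, ev₂_comul h, fun b v hv => target_counit h hv⟩

end GaloisSystem

/-! ### The basic construction -/

namespace StronglySeparableExt

section BasicLemmas

variable {k S R : Type*} [Field k] [Ring S] [Algebra k S] [Ring R] [Algebra k R]
  (D : StronglySeparableExt k S R)

theorem ext_E {x y : R} (h : ∀ r, D.E (x * r) = D.E (y * r)) : x = y := by
  rw [← D.dual_left x, ← D.dual_left y]
  simp only [h]

theorem ext_toEnd {f g : D.Alg} (h : ∀ r, D.toEnd f r = D.toEnd g r) : f = g :=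
  D.toEnd_injective (LinearMap.ext h)

theorem mem_U_iff {u : R} : u ∈ D.U ↔ ∀ s, D.incl s * u = u * D.incl s := by
  simp [U, Subalgebra.mem_centralizer_iff]

theorem mem_V_iff {v : D.Alg} :
    v ∈ D.V ↔ ∀ r r', D.toEnd v (r * r') = r * D.toEnd v r' := by
  have h : v ∈ D.V ↔ ∀ r, D.leftMul r * v = v * D.leftMul r := by
    simp only [V, Subalgebra.mem_centralizer_iff, Set.forall_mem_range]
    rfl
  rw [h]
  refine forall_congr' fun r => ⟨fun h r' => ?_, fun h => D.ext_toEnd fun r' => ?_⟩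
  · simpa using (congrArg (fun g => D.toEnd g r') h).symm
  · simp [h]

theorem mem_A_iff {a : D.Alg} :
    a ∈ D.A ↔ ∀ s r, D.toEnd a (D.incl s * r) = D.incl s * D.toEnd a r := by
  have h : a ∈ D.A ↔ ∀ s, D.leftMul (D.incl s) * a = a * D.leftMul (D.incl s) := by
    simp only [A, Subalgebra.mem_centralizer_iff, Set.forall_mem_range]
    rfl
  rw [h]
  refine forall_congr' fun r => ⟨fun h r' => ?_, fun h => D.ext_toEnd fun r' => ?_⟩
  · simpa using (congrArg (fun g => D.toEnd g r') h).symm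
  · simp [h]

theorem mem_A_iff_mul {a : D.Alg} :
    a ∈ D.A ↔ ∀ s, D.leftMul (D.incl s) * a = a * D.leftMul (D.incl s) := by
  simp only [A, Subalgebra.mem_centralizer_iff, Set.forall_mem_range]
  rfl

theorem V_le_A : D.V ≤ D.A := fun _ hv =>
  D.mem_A_iff.2 fun _ _ => D.mem_V_iff.1 hv _ _

theorem toEnd_eq_mul {v : D.Alg} (hv : v ∈ D.V) (r : R) :
    D.toEnd v r = r * D.toEnd v 1 := by
  conv_lhs => rw [← mul_one r]
  exact D.mem_V_iff.1 hv r 1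

theorem toEnd_one_mem {a : D.Alg} (ha : a ∈ D.A) : D.toEnd a 1 ∈ D.U :=
  D.mem_U_iff.2 fun s => by
    rw [← D.mem_A_iff.1 ha, ← D.toEnd_mul_incl, one_mul, mul_one]

theorem leftMul_mem_A {u : R} (hu : u ∈ D.U) : D.leftMul u ∈ D.A :=
  D.mem_A_iff.2 fun s r => by
    rw [toEnd_leftMul, toEnd_leftMul, ← mul_assoc, ← mul_assoc, D.mem_U_iff.1 hu]

theorem condExp_mem_U {a : D.Alg} (ha : a ∈ D.A) : D.condExp a ∈ D.U :=
  D.mem_U_iff.2 fun s => by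
    rw [← condExp_leftMul_mul, ← condExp_mul_leftMul, D.mem_A_iff_mul.1 ha]

/-- The values of `E` lie in `S`, over which `f` is right linear. -/
theorem mul_leftMul_jones (f : D.Alg) (r : R) :
    f * D.leftMul r * D.jones = D.leftMul (D.toEnd f r) * D.jones :=
  D.ext_toEnd fun r' => by simp [D.toEnd_mul_incl]

theorem mul_jones (f : D.Alg) : f * D.jones = D.leftMul (D.toEnd f 1) * D.jones := by
  rw [← mul_leftMul_jones, map_one, mul_one]

theorem condExp_leftMul_jones (r : R) : D.condExp (D.leftMul r * D.jones) = D.lam • r := by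
  rw [condExp_leftMul_mul, condExp_jones, ← Algebra.commutes, Algebra.smul_def]

/-- Right multiplications by `U`, as elements of the basic construction. -/
def rightMul : D.U →ₗ[k] D.V where
  toFun u := ⟨(⟨LinearMap.mulRight k (u : R), fun r s => by
      simp only [LinearMap.mulRight_apply, mul_assoc]
      rw [D.mem_U_iff.1 u.2]⟩ : D.Alg), D.mem_V_iff.2 fun r r' => mul_assoc r r' u⟩
  map_add' u u' := Subtype.ext (D.ext_toEnd fun r => mul_add r (u : R) u')
  map_smul' c u := Subtype.ext (D.ext_toEnd fun r => mul_smul_comm c r (u : R))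

/-- `U` and `V` are anti-isomorphic. -/
def equivUV : D.U ≃ₗ[k] D.V where
  __ := D.rightMul
  invFun v := ⟨D.toEnd (v : D.Alg) 1, D.toEnd_one_mem (D.V_le_A v.2)⟩
  left_inv u := Subtype.ext (one_mul (u : R))
  right_inv v := Subtype.ext (D.ext_toEnd fun r => (D.toEnd_eq_mul v.2 r).symm)

theorem equivUV_mul (u u' : D.U) : D.equivUV (u * u') = D.equivUV u' * D.equivUV u :=
  Subtype.ext (D.ext_toEnd fun r => (mul_assoc r (u : R) u').symm)

/-- The adjoint of a bimodule endomorphism of `R` with respect to `E`. -/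
def adj : D.A →ₗ[k] D.A :=
  -- The formula `r ↦ ∑ E(r b(x i)) y i` is forced by the adjunction and the dual bases.
  have hE : ∀ (b : D.A) (r r' : R),
      D.E ((∑ i, D.incl (D.E (r * D.toEnd (b : D.Alg) (D.x i))) * D.y i) * r') =
        D.E (r * D.toEnd (b : D.Alg) r') := by
    intro b r r'
    conv_rhs => rw [← D.dual_right r']
    simp only [Finset.sum_mul, map_sum, Finset.mul_sum, mul_assoc, D.E_left, D.toEnd_mul_incl]
    simp only [← mul_assoc, D.E_right]
  { toFun b := ⟨(⟨∑ i, LinearMap.mulRight k (D.y i) ∘ₗ D.incl.toLinearMap ∘ₗ D.E ∘ₗ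
        LinearMap.mulRight k (D.toEnd (b : D.Alg) (D.x i)), fun r s => D.ext_E fun r' => by
          simp only [LinearMap.sum_apply, LinearMap.comp_apply, LinearMap.mulRight_apply,
            AlgHom.toLinearMap_apply]
          rw [hE, mul_assoc (Finset.sum _ _), hE, D.mem_A_iff.1 b.2, mul_assoc]⟩ : D.Alg),
        D.mem_A_iff.2 fun s r => by
          change (∑ i, LinearMap.mulRight k (D.y i) ∘ₗ D.incl.toLinearMap ∘ₗ D.E ∘ₗ
            LinearMap.mulRight k (D.toEnd (b : D.Alg) (D.x i))) _ =
            _ * (∑ i, LinearMap.mulRight k (D.y i) ∘ₗ D.incl.toLinearMap ∘ₗ D.E ∘ₗ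
            LinearMap.mulRight k (D.toEnd (b : D.Alg) (D.x i))) _
          simp only [LinearMap.sum_apply, LinearMap.comp_apply, LinearMap.mulRight_apply,
            AlgHom.toLinearMap_apply, mul_assoc, D.E_left, map_mul, Finset.mul_sum]⟩
    map_add' b b' := Subtype.ext (D.ext_toEnd fun r => by
      change (∑ i, LinearMap.mulRight k (D.y i) ∘ₗ D.incl.toLinearMap ∘ₗ D.E ∘ₗ
            LinearMap.mulRight k (D.toEnd ((b : D.Alg) + b') (D.x i))) _ =
          (∑ i, LinearMap.mulRight k (D.y i) ∘ₗ D.incl.toLinearMap ∘ₗ D.E ∘ₗ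
            LinearMap.mulRight k (D.toEnd (b : D.Alg) (D.x i))) _ +
          (∑ i, LinearMap.mulRight k (D.y i) ∘ₗ D.incl.toLinearMap ∘ₗ D.E ∘ₗ
            LinearMap.mulRight k (D.toEnd (b' : D.Alg) (D.x i))) _
      simp [mul_add, add_mul, Finset.sum_add_distrib])
    map_smul' c b := Subtype.ext (D.ext_toEnd fun r => by
      change (∑ i, LinearMap.mulRight k (D.y i) ∘ₗ D.incl.toLinearMap ∘ₗ D.E ∘ₗ
            LinearMap.mulRight k (D.toEnd (c • (b : D.Alg)) (D.x i))) _ =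
          c • (∑ i, LinearMap.mulRight k (D.y i) ∘ₗ D.incl.toLinearMap ∘ₗ D.E ∘ₗ
            LinearMap.mulRight k (D.toEnd (b : D.Alg) (D.x i))) _
      simp [Finset.smul_sum]) }

theorem E_adj (b : D.A) (r r' : R) :
    D.E (D.toEnd (D.adj b : D.Alg) r * r') = D.E (r * D.toEnd (b : D.Alg) r') := by
  change D.E ((∑ i, LinearMap.mulRight k (D.y i) ∘ₗ D.incl.toLinearMap ∘ₗ D.E ∘ₗ
            LinearMap.mulRight k (D.toEnd (b : D.Alg) (D.x i))) r * r') = _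
  conv_rhs => rw [← D.dual_right r']
  simp only [LinearMap.sum_apply, LinearMap.comp_apply, LinearMap.mulRight_apply,
    AlgHom.toLinearMap_apply, Finset.sum_mul, map_sum, Finset.mul_sum, mul_assoc, D.E_left,
    D.toEnd_mul_incl]
  simp only [← mul_assoc, D.E_right]

/-- This moves an operator past a Jones idempotent from the right, at the price of its adjoint. -/
theorem jones_leftMul_mul_mem_A (b : D.A) (r : R) :
    D.jones * D.leftMul r * b = D.jones * D.leftMul (D.toEnd (D.adj b : D.Alg) r) :=
  D.ext_toEnd fun r' => by simp [D.E_adj]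

/-- The bimodule endomorphism `r ↦ E_R(b r u)` of `R`. -/
def slice (b u : D.A) : D.A :=
  ⟨(⟨D.condExp ∘ₗ LinearMap.mulRight k (u : D.Alg) ∘ₗ LinearMap.mulLeft k (b : D.Alg) ∘ₗ
      D.leftMul.toLinearMap, fun r s => by
        simp only [LinearMap.comp_apply, LinearMap.mulLeft_apply, LinearMap.mulRight_apply,
          AlgHom.toLinearMap_apply, map_mul, ← condExp_mul_leftMul, mul_assoc]
        rw [D.mem_A_iff_mul.1 u.2]⟩ : D.Alg),
    D.mem_A_iff.2 fun s r => by
      change D.condExp (b * D.leftMul (D.incl s * r) * u) =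
        D.incl s * D.condExp (b * D.leftMul r * u)
      rw [map_mul D.leftMul, ← mul_assoc (b : D.Alg), ← D.mem_A_iff_mul.1 b.2, mul_assoc (D.leftMul _),
        mul_assoc (D.leftMul _), condExp_leftMul_mul]⟩

/-- `b(r r') = ∑ j, E_R(b r z j) w j(r')`. -/
theorem toEnd_mul_eq_sum {m : ℕ} {z w : Fin m → D.Alg} (hz : ∀ j, z j ∈ D.A)
    (h : D.basic.IsDualBases z w) (b : D.A) (r r' : R) :
    D.toEnd (b : D.Alg) (r * r') =
      ∑ j, D.toEnd (D.slice b ⟨z j, hz j⟩ : D.Alg) r * D.toEnd (w j) r' := by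
  -- The dual basis expansion of the operator `b ∘ ℓ_r`, evaluated at `r'`.
  have h1 := congrArg (fun f => D.toEnd f r') (h.1 (b * D.leftMul r))
  simp only [map_sum, map_mul, LinearMap.sum_apply, Module.End.mul_apply, toEnd_leftMul] at h1
  rw [← h1]
  rfl

/-- A trace property passes to the basic construction. -/
theorem IsMarkovTrace.basic {D : StronglySeparableExt k S R} {T : S →ₗ[k] k}
    (hT : D.IsMarkovTrace T) : D.basic.IsMarkovTrace (T ∘ₗ D.E) where
  trace := hT.trace_comp
  one := by simp [D.E_one, hT.one]
  trace_comp a b := by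
    -- On elements `r e₁ r'` and `s e₁ s'`, which span, the trace is `λ T(E(r's) E(s'r))`; this is
    -- symmetric because `T` is a trace on `S`.
    have key : ∀ r r' s s' : R,
        T (D.E (D.condExp ((D.leftMul r * D.jones * D.leftMul r') *
          (D.leftMul s * D.jones * D.leftMul s')))) =
        D.lam • T (D.E (r' * s) * D.E (s' * r)) := by
      intro r r' s s'
      have h : (D.leftMul r * D.jones * D.leftMul r') * (D.leftMul s * D.jones * D.leftMul s') =
          D.leftMul (r * D.incl (D.E (r' * s))) * D.jones * D.leftMul s' := by
        have := D.jones_leftMul_jones (r' * s)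
        simp only [map_mul] at this ⊢
        simp only [mul_assoc] at this ⊢
        rw [← mul_assoc (D.leftMul s) D.jones, ← mul_assoc (D.leftMul r') _ (D.leftMul s'),
          ← mul_assoc D.jones _ (D.leftMul s'), this]
        simp only [mul_assoc]
      rw [h, condExp_leftMul_jones_leftMul, map_smul, map_smul, mul_assoc, hT.trace_comp,
        mul_assoc, D.E_left]
    change T (D.E (D.condExp (a * b))) = T (D.E (D.condExp (b * a)))
    rw [← D.sum_toEnd_jones a, ← D.sum_toEnd_jones b]
    simp only [Finset.sum_mul, Finset.mul_sum, map_sum, key]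
    rw [Finset.sum_comm]
    refine Finset.sum_congr rfl fun i _ => Finset.sum_congr rfl fun j _ => ?_
    rw [hT.trace]

end BasicLemmas

end StronglySeparableExt

/-! ### The tower: `B` as operators on `A`, traces and perfectness of the pairing. -/

namespace StronglySeparableExt

section TowerLemmas

variable {k N M : Type*} [Field k] [Ring N] [Algebra k N] [Ring M] [Algebra k M]
  (D : StronglySeparableExt k N M)

/-- From `b x e₂ = b(x) e₂` and `E_{M₁}(e₂) = λ`. -/
theorem act_apply (b : D.B) (x : D.Alg) : D.act b x = D.basic.toEnd (b : D.basic.Alg) x := by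
  change D.lam⁻¹ • D.basic.condExp ((b : D.basic.Alg) * D.basic.leftMul x * D.basic.jones) = _
  rw [mul_leftMul_jones, condExp_leftMul_jones]
  exact inv_smul_smul₀ D.lam_ne_zero _

theorem toEnd_mem_A (b : D.B) (a : D.A) :
    D.basic.toEnd (b : D.basic.Alg) (a : D.Alg) ∈ D.A :=
  D.mem_A_iff_mul.2 fun s => by
    change D.basic.incl (D.incl s) * _ = _ * D.basic.incl (D.incl s)
    rw [← D.basic.mem_A_iff.1 b.2, ← toEnd_mul_incl]
    exact congrArg _ (D.mem_A_iff_mul.1 a.2 s)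

theorem toEnd_mem_V (b : D.B) (v : D.V) :
    D.basic.toEnd (b : D.basic.Alg) (v : D.Alg) ∈ D.V :=
  D.basic.mem_U_iff.2 fun m => by
    rw [← D.basic.mem_A_iff.1 b.2, ← toEnd_mul_incl]
    exact congrArg _ (D.basic.mem_U_iff.1 v.2 m)

/-- The action of `B` on `A`. -/
def actA : D.B →ₐ[k] Module.End k D.A where
  toFun b := ((D.basic.toEnd (b : D.basic.Alg)) ∘ₗ D.A.val.toLinearMap).codRestrict
    (Subalgebra.toSubmodule D.A) (fun a => D.toEnd_mem_A b a)
  map_one' := rfl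
  map_mul' _ _ := rfl
  map_zero' := rfl
  map_add' _ _ := rfl
  commutes' _ := rfl

@[simp] theorem coe_actA (b : D.B) (a : D.A) :
    (D.actA b a : D.Alg) = D.basic.toEnd (b : D.basic.Alg) (a : D.Alg) := rfl

variable (T : N →ₗ[k] k)

/-- The counit `a ↦ T(a(1) w(1))` of `A`. -/
def counitA (w : D.V) : D.A →ₗ[k] k :=
  T ∘ₗ D.E ∘ₗ LinearMap.mulRight k (D.toEnd (w : D.Alg) 1) ∘ₗ
    (LinearMap.applyₗ (1 : M)) ∘ₗ D.toEnd.toLinearMap ∘ₗ D.A.val.toLinearMap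

theorem counitA_apply (w : D.V) (a : D.A) :
    D.counitA T w a = T (D.E (D.toEnd (a : D.Alg) 1 * D.toEnd (w : D.Alg) 1)) := rfl

variable {D T}

theorem trace₁_mul_comm (hT : D.IsMarkovTrace T) (x y : D.Alg) :
    D.trace₁ T (x * y) = D.trace₁ T (y * x) := hT.basic.trace_comp x y

theorem trace₂_mul_comm (hT : D.IsMarkovTrace T) (x y : D.basic.Alg) :
    D.trace₂ T (x * y) = D.trace₂ T (y * x) := hT.basic.basic.trace_comp x y

theorem trace₁_mul_jones (x : D.Alg) :
    D.trace₁ T (x * D.jones) = D.lam * T (D.E (D.toEnd x 1)) := by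
  rw [D.mul_jones]
  change T (D.E (D.condExp _)) = _
  rw [condExp_leftMul_jones, map_smul, map_smul, smul_eq_mul]

theorem trace₂_incl_mul_e₂_mul_incl (x y : D.Alg) :
    D.trace₂ T (D.basic.basic.incl x * D.e₂ * D.basic.basic.incl y) = D.lam * D.trace₁ T (x * y) := by
  change D.trace₁ T (D.basic.condExp (D.basic.leftMul x * D.basic.jones * D.basic.leftMul y)) = _
  rw [condExp_leftMul_jones_leftMul, map_smul, smul_eq_mul]
  rfl

theorem trace₁_mul_mul_jones (w : D.V) (x : D.Alg) :
    D.trace₁ T (w * x * D.jones) =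
      D.lam * T (D.E (D.toEnd x 1 * D.toEnd (w : D.Alg) 1)) := by
  rw [trace₁_mul_jones, map_mul, Module.End.mul_apply, D.toEnd_eq_mul w.2]

/-- Cyclicity brings `b` in front of `a e₂`, where it becomes `b(a) e₂`. Each Jones idempotent then
contributes a factor `λ`, cancelled by `λ⁻²`. -/
theorem pairing_apply (hT : D.IsMarkovTrace T) (w : D.V) (a : D.A) (b : D.B) :
    D.pairing T w a b = D.counitA T w (D.actA b a) := by
  have h : (b : D.basic.Alg) * (D.inclA a * D.e₂ * D.e₁ * D.inclV w) =
      D.basic.basic.incl (D.actA b a : D.Alg) * D.e₂ *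
        D.basic.basic.incl (D.jones * (w : D.Alg)) := by
    have := D.basic.mul_leftMul_jones b (a : D.Alg)
    rw [map_mul, ← mul_assoc, ← mul_assoc, ← mul_assoc]
    exact congrArg (fun z => z * D.e₁ * D.inclV w) this
  change (D.lam⁻¹) ^ 2 * D.trace₂ T (D.inclA a * D.e₂ * D.e₁ * D.inclV w * (b : D.basic.Alg)) = _
  rw [trace₂_mul_comm hT, h, trace₂_incl_mul_e₂_mul_incl, ← mul_assoc (D.actA b a : D.Alg),
    trace₁_mul_comm hT _ (w : D.Alg), ← mul_assoc (w : D.Alg), trace₁_mul_mul_jones, counitA_apply]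
  have := D.lam_ne_zero
  field_simp

/-- An element `v ∈ V` is right multiplication by `v(1)`, so `E_M(v) = λ ∑ x i v(1) y i`, and the
trace brings `y i x i` together. -/
theorem trace₁_of_mem_V (hT : D.IsMarkovTrace T)
    (hprod : ∑ i, D.y i * D.x i = algebraMap k M D.lam⁻¹) {v : D.Alg} (hv : v ∈ D.V) :
    D.trace₁ T v = T (D.E (D.toEnd v 1)) := by
  change T (D.E (D.condExp v)) = _
  have h : ∀ i, T (D.E (D.toEnd v (D.x i) * D.y i)) =
      T (D.E (D.toEnd v 1 * (D.y i * D.x i))) := by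
    intro i
    rw [D.toEnd_eq_mul hv, mul_assoc, hT.trace_comp, mul_assoc]
  rw [condExp_apply, map_smul, map_smul, map_sum, map_sum]
  simp only [h]
  rw [← map_sum, ← map_sum, ← Finset.mul_sum, hprod, ← Algebra.commutes, ← Algebra.smul_def,
    map_smul, map_smul, smul_inv_smul₀ D.lam_ne_zero]

theorem trace₁_nondeg_V (hT : D.IsMarkovTrace T)
    (hprod : ∑ i, D.y i * D.x i = algebraMap k M D.lam⁻¹) (hTU : D.TraceNondegOnU T)
    (v : D.V) (hv : ∀ v' : D.V, D.trace₁ T ((v * v' : D.V) : D.Alg) = 0) : v = 0 := by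
  have h : D.equivUV.symm v = 0 := Subtype.ext <| hTU _ (D.equivUV.symm v).2 fun u hu => by
    have h1 := hv (D.rightMul ⟨u, hu⟩)
    rw [trace₁_of_mem_V hT hprod (v * _ : D.V).2] at h1
    change T (D.E (D.toEnd (v : D.Alg) (1 * u))) = 0 at h1
    rwa [one_mul, D.toEnd_eq_mul v.2, hT.trace_comp] at h1
  simpa using h

/-- The coefficients `E_M(a z j)` of `a` lie in `U`, and testing `a` against `z j u` shows that they
are orthogonal to `U`. -/
theorem trace₁_nondeg_A (hT : D.IsMarkovTrace T) (hTU : D.TraceNondegOnU T) {m : ℕ}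
    {z w : Fin m → D.Alg} (hz : ∀ j, z j ∈ D.A) (h : D.basic.IsDualBases z w)
    (a : D.A) (ha : ∀ a' : D.A, D.trace₁ T (a' * a) = 0) : a = 0 := by
  refine Subtype.ext ?_
  rw [← h.1 (a : D.Alg)]
  refine Finset.sum_eq_zero fun j _ => ?_
  have h0 : D.condExp (a * z j) = 0 := hTU _ (D.condExp_mem_U (mul_mem a.2 (hz j)))
    fun u hu => by
      rw [← condExp_mul_leftMul, mul_assoc]
      have h1 := ha (⟨z j, hz j⟩ * ⟨_, D.leftMul_mem_A hu⟩)
      rw [trace₁_mul_comm hT] at h1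
      exact h1
  change D.leftMul (D.condExp (a * z j)) * _ = 0
  rw [h0, map_zero, zero_mul]

theorem finiteDimensional_A [FiniteDimensional k D.U] {m : ℕ}
    {z w : Fin m → D.Alg} (hz : ∀ j, z j ∈ D.A) (h : D.basic.IsDualBases z w) :
    FiniteDimensional k D.A := by
  let F : D.A →ₗ[k] (Fin m → D.U) := LinearMap.pi fun j =>
    (D.condExp ∘ₗ LinearMap.mulRight k (z j) ∘ₗ D.A.val.toLinearMap).codRestrict
      (Subalgebra.toSubmodule D.U) (fun a => D.condExp_mem_U (mul_mem a.2 (hz j)))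
  refine FiniteDimensional.of_injective F fun a a' haa => Subtype.ext ?_
  rw [← h.1 (a : D.Alg), ← h.1 (a' : D.Alg)]
  refine Finset.sum_congr rfl fun j _ => ?_
  have : D.condExp (a * z j) = D.condExp (a' * z j) := congrArg Subtype.val (congrFun haa j)
  change D.leftMul (D.condExp (a * z j)) * _ = D.leftMul (D.condExp (a' * z j)) * _
  rw [this]

/-- Dual bases in `A` generate `M₁` as an `M`-module. -/
theorem span_leftMul_mul_A {m : ℕ} {z w : Fin m → D.Alg} (hw : ∀ j, w j ∈ D.A)
    (h : D.basic.IsDualBases z w) :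
    Submodule.span k {x : D.Alg | ∃ (m : M) (a : D.A), x = D.basic.incl m * a} = ⊤ := by
  refine eq_top_iff.2 fun x _ => ?_
  rw [← h.1 x]
  exact Submodule.sum_mem _ fun j _ => Submodule.subset_span ⟨_, ⟨w j, hw j⟩, rfl⟩

/-- Dual bases in `A` generate `M₁` as a right `M`-module. -/
theorem span_A_mul_leftMul {m : ℕ} {z w : Fin m → D.Alg} (hz : ∀ j, z j ∈ D.A)
    (h : D.basic.IsDualBases z w) :
    Submodule.span k {x : D.Alg | ∃ (a : D.A) (m : M), x = a * D.basic.incl m} = ⊤ := by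
  refine eq_top_iff.2 fun x _ => ?_
  rw [← h.2 x]
  exact Submodule.sum_mem _ fun j _ => Submodule.subset_span ⟨⟨z j, hz j⟩, _, rfl⟩

theorem act_mul_leftMul (b : D.B) (x : D.Alg) (m : M) :
    D.act b (x * D.basic.incl m) = D.act b x * D.basic.incl m := by
  rw [act_apply, act_apply, toEnd_mul_incl]

theorem act_leftMul_mul (b : D.B) (m : M) (x : D.Alg) :
    D.act b (D.basic.incl m * x) = D.basic.incl m * D.act b x := by
  rw [act_apply, act_apply, D.basic.mem_A_iff.1 b.2]

/-- `M₂ = M₁ B`: every element of `M₂` acts as a combination `∑ j, c j b j` with `b j ∈ B`. -/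
theorem toEnd_eq_sum {m : ℕ} {u v : Fin m → D.basic.Alg} (hv : ∀ j, v j ∈ D.B)
    (h : D.basic.basic.IsDualBases u v) (X : D.basic.Alg) : ∃ c : Fin m → D.Alg,
    ∀ x, D.basic.toEnd X x = ∑ j, c j * D.act ⟨v j, hv j⟩ x := by
  refine ⟨fun j => D.basic.basic.E (X * u j), fun x => ?_⟩
  conv_lhs => rw [← h.1 X]
  simp only [map_sum, map_mul, LinearMap.sum_apply, Module.End.mul_apply, act_apply]
  rfl

/-- The pairing of `A` and `B` is perfect. -/
theorem isPerfPair_pairing (hT : D.IsMarkovTrace T) (hTU : D.TraceNondegOnU T)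
    [FiniteDimensional k D.U] (hdepth : D.IsDepthTwo) {w c : D.V}
    (hwc : w * c = 1) (hcw : c * w = 1) :
    (D.pairing T w).IsPerfPair := by
  obtain ⟨⟨m, z, z', hz, hzd⟩, ⟨m', u, v, hu, huv⟩⟩ := hdepth
  have hfd : FiniteDimensional k D.A := finiteDimensional_A (fun j => (hz j).1) hzd
  have hw1 : D.toEnd (w : D.Alg) 1 * D.toEnd (c : D.Alg) 1 = 1 := by
    rw [← D.toEnd_eq_mul c.2, ← Module.End.mul_apply, ← map_mul, ← Subalgebra.coe_mul, hcw]
    simp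
  have hw2 : D.toEnd (c : D.Alg) 1 * D.toEnd (w : D.Alg) 1 = 1 := by
    rw [← D.toEnd_eq_mul w.2, ← Module.End.mul_apply, ← map_mul, ← Subalgebra.coe_mul, hwc]
    simp
  -- Since `w(1)` is invertible in `U`, twisting the trace by it preserves non-degeneracy.
  have hu0 : ∀ u ∈ D.U, (∀ u' ∈ D.U, T (D.E (u' * u * D.toEnd (w : D.Alg) 1)) = 0) → u = 0 := by
    intro u hu h
    have h1 : u * D.toEnd (w : D.Alg) 1 = 0 :=
      hTU _ (mul_mem hu (D.toEnd_one_mem (D.V_le_A w.2))) fun u' hu' => by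
        rw [hT.trace_comp, ← mul_assoc, h u' hu']
    rw [← mul_one u, ← hw1, ← mul_assoc, h1, zero_mul]
  have hpair : ∀ (a : D.A) (b : D.B), D.pairing T w a b =
      T (D.E (D.toEnd (D.act b a) 1 * D.toEnd (w : D.Alg) 1)) := fun a b => by
    rw [pairing_apply hT, counitA_apply, act_apply, coe_actA]
  have hmem : ∀ (a : D.A) (b : D.B), D.toEnd (D.act b a) 1 ∈ D.U := fun a b => by
    rw [act_apply]; exact D.toEnd_one_mem (D.toEnd_mem_A b a)
  refine LinearMap.IsPerfPair.of_injective ?_ ?_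
  · rw [← LinearMap.ker_eq_bot, LinearMap.ker_eq_bot']
    intro a ha
    have h1 : ∀ b : D.B, D.toEnd (D.act b a) 1 = 0 := by
      intro b
      have h0 : D.toEnd (w : D.Alg) 1 * D.toEnd (D.act b a) 1 = 0 := by
        refine hTU _ (mul_mem (D.toEnd_one_mem (D.V_le_A w.2)) (hmem a b)) fun u' hu' => ?_
        -- Multiplying `b` on the left by right multiplication by `u'`, an element of `V`, changes
        -- `b(a)(1)` into `b(a)(1) u'`.
        have h : D.pairing T w a (⟨D.basic.leftMul (D.rightMul ⟨u', hu'⟩),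
          D.basic.leftMul_mem_A (D.rightMul ⟨u', hu'⟩).2⟩ * b) = 0 := by rw [ha]; rfl
        rw [hpair] at h
        rw [mul_assoc, hT.trace_comp, ← h]
        simp only [act_apply]
        rfl
      have h3 := congrArg (fun x => D.toEnd (c : D.Alg) 1 * x) h0
      simpa only [← mul_assoc, hw2, one_mul, mul_zero] using h3
    have h2 : ∀ X : D.basic.Alg, D.toEnd (D.basic.toEnd X a) 1 = 0 := by
      intro X
      obtain ⟨c, hc⟩ := toEnd_eq_sum (fun j => (hu j).2) huv X
      simp [hc, h1]
    refine Subtype.ext ?_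
    rw [← hzd.2 (a : D.Alg)]
    refine Finset.sum_eq_zero fun j _ => ?_
    -- The operator `e₂ z' j` extracts the coefficient `E_M(z' j a)` of `a`.
    have h3 := h2 (D.basic.jones * D.basic.leftMul (z' j))
    rw [map_mul, Module.End.mul_apply, toEnd_leftMul, toEnd_jones] at h3
    change D.toEnd (D.leftMul _) 1 = 0 at h3
    rw [toEnd_leftMul, mul_one] at h3
    rw [h3, map_zero, mul_zero]
  · rw [← LinearMap.ker_eq_bot, LinearMap.ker_eq_bot']
    intro b hb
    have h1 : ∀ a : D.A, D.toEnd (D.act b a) 1 = 0 := by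
      refine fun a => hu0 _ (hmem a b) fun u' hu' => ?_
      have h : (D.pairing T w).flip b (⟨D.leftMul u', D.leftMul_mem_A hu'⟩ * a) = 0 := by
        rw [hb]; rfl
      rw [LinearMap.flip_apply, hpair] at h
      rw [← h]
      congr 3
      change _ = D.toEnd (D.act b (D.basic.incl u' * a)) 1
      rw [act_leftMul_mul, map_mul]
      rfl
    have h2 : ∀ x : D.Alg, D.toEnd (D.act b x) 1 = 0 := by
      intro x
      rw [← hzd.1 x, map_sum, map_sum, LinearMap.sum_apply]
      refine Finset.sum_eq_zero fun j _ => ?_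
      rw [act_leftMul_mul, map_mul, Module.End.mul_apply, h1 ⟨z' j, (hz j).2⟩, map_zero]
    refine Subtype.ext (D.basic.ext_toEnd fun x => D.ext_toEnd fun m => ?_)
    -- By right `M`-linearity `b(xm)(1) = b(x)(m)`, so vanishing at `1` gives vanishing everywhere.
    have h3 := h2 (x * D.basic.incl m)
    rw [act_apply, toEnd_mul_incl, map_mul, Module.End.mul_apply] at h3
    change D.toEnd _ (m * 1) = 0 at h3
    rw [mul_one] at h3
    exact h3

/-- The weak Hopf datum of a depth two tower. -/
theorem exists_galoisSystem (hT : D.IsMarkovTrace T)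
    (hprod : ∑ i, D.y i * D.x i = algebraMap k M D.lam⁻¹) (hTU : D.TraceNondegOnU T)
    (hdepth : D.IsDepthTwo) {w c : D.V} {s : Finset (D.V × D.V)} (hwc : w * c = 1)
    (hcw : c * w = 1) (hc : ∀ v, c * v = v * c) (hs : ∑ i ∈ s, i.1 * i.2 = 1)
    (hs' : ∑ i ∈ s, i.2 * i.1 = 1)
    (hsum : ∀ v : D.V, ∑ i ∈ s, D.trace₁ T ((i.2 * v : D.V) : D.Alg) • i.1 = v * c)
    (hsum' : ∀ v : D.V, ∑ i ∈ s, D.trace₁ T ((i.1 * v : D.V) : D.Alg) • i.2 = v * c)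
    (hperf : (D.pairing T w).IsPerfPair) :
    ∃ G : GaloisSystem k D.A D.B D.V, G.φ = D.actA ∧ G.ε = D.counitA T w ∧ G.w = w ∧
      (∀ v, ((G.ι v : D.A) : D.Alg) = v) ∧ (∀ v, (G.L v : D.basic.Alg) = D.basic.leftMul v) ∧
      G.star = D.basic.adj := by
  obtain ⟨⟨m, z, z', hz, hzd⟩, ⟨m', u, v, hu, huv⟩⟩ := hdepth
  have hε : ∀ v : D.V, D.counitA T w ⟨v, D.V_le_A v.2⟩ =
      D.trace₁ T ((v * w : D.V) : D.Alg) := by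
    intro v
    rw [Subalgebra.coe_mul, trace₁_mul_comm hT, ← Subalgebra.coe_mul,
      trace₁_of_mem_V hT hprod (w * v : D.V).2, Subalgebra.coe_mul, map_mul,
      Module.End.mul_apply, D.toEnd_eq_mul w.2]
    rfl
  have hw : ∀ v, w * v = v * w := fun v => by
    calc w * v = w * v * (c * w) := by rw [hcw, mul_one]
      _ = w * (v * c) * w := by simp only [mul_assoc]
      _ = (w * c) * v * w := by rw [← hc]; simp only [mul_assoc]
      _ = v * w := by rw [hwc, one_mul]
  have hperf' : (D.actA.toLinearMap.compr₂ (D.counitA T w)).flip.IsPerfPair := by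
    have h : (D.actA.toLinearMap.compr₂ (D.counitA T w)).flip = D.pairing T w :=
      LinearMap.ext₂ fun a b => (pairing_apply hT w a b).symm
    rwa [h]
  exact ⟨{
    ι := Subalgebra.inclusion D.V_le_A
    φ := D.actA
    L := (D.basic.leftMul.toLinearMap ∘ₗ D.V.val.toLinearMap).codRestrict
      (Subalgebra.toSubmodule D.B) (fun v => D.basic.leftMul_mem_A v.2)
    -- Here `V` plays the role of `U` for the extension `M ↪ M₁`, so its right multiplications lie
    -- in `C_{M₂}(M₁) ⊆ B`.
    R := ((Subalgebra.inclusion D.basic.V_le_A).toLinearMap ∘ₗ D.basic.rightMul :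
      D.basic.U →ₗ[k] D.basic.A)
    φ_L := fun _ _ => rfl
    φ_R := fun _ _ => rfl
    stable := fun b v => ⟨⟨_, D.toEnd_mem_V b v⟩, rfl⟩
    τ := D.trace₁ T ∘ₗ D.A.val.toLinearMap
    τ_comm := fun x y => trace₁_mul_comm hT x y
    τ_nondeg := fun x hx => trace₁_nondeg_A hT hTU (fun j => (hz j).1) hzd x hx
    star := D.basic.adj
    τ_star := fun b x y => congrArg (fun m => T (D.E m)) (D.basic.E_adj b (x : D.Alg) y)
    ε := D.counitA T w
    w := w
    c := c
    w_mul_c := hwc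
    c_mul_w := hcw
    c_central := hc
    ε_ι := hε
    -- The counit sees only the value at `1`, and `y` agrees there with right multiplication by
    -- `y(1)`, an element of `V`.
    ε_mul := fun y => ⟨D.rightMul ⟨_, D.toEnd_one_mem y.2⟩, fun x => by
      rw [counitA_apply, counitA_apply]
      change _ = T (D.E (D.toEnd (x : D.Alg) (1 * D.toEnd (y : D.Alg) 1) * _))
      rw [one_mul]
      rfl⟩
    s := s
    sum_mul := hs
    sum_mul' := hs'
    sum_ε := fun v => by
      -- The twist by `w` in `ε(v) = τ(vw)` cancels the defect `c` in `∑ τ(qv) p = vc`.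
      have h := hsum (v * w)
      rw [mul_assoc, hwc, mul_one] at h
      conv_rhs => rw [← h]
      refine Finset.sum_congr rfl fun i _ => ?_
      rw [← mul_assoc, ← hε]
      rfl
    sum_ε' := fun v => by
      have h := hsum' (w * v)
      rw [hw, mul_assoc, hwc, mul_one] at h
      conv_rhs => rw [← h]
      refine Finset.sum_congr rfl fun i _ => ?_
      rw [Subalgebra.coe_mul, trace₁_mul_comm hT, ← Subalgebra.coe_mul, mul_assoc, hw, ← mul_assoc,
        ← hε]
      rfl
    perf := hperf'
    galois := fun b => ⟨∑ j, D.basic.slice b ⟨u j, (hu j).1⟩ ⊗ₜ[k] (⟨v j, (hu j).2⟩ : D.B),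
      fun x y => by
        rw [map_sum, map_sum]
        refine Subtype.ext ?_
        rw [coe_actA]
        refine Eq.trans ?_ (D.basic.toEnd_mul_eq_sum (fun j => (hu j).1) huv b (x : D.Alg)
          (y : D.Alg)).symm
        simp only [AddSubmonoidClass.coe_finsetSum]
        rfl⟩ }, rfl, rfl, rfl, fun _ => rfl, fun _ => rfl, rfl⟩

end TowerLemmas

end StronglySeparableExt

/-! ### The module algebra `M₁`, its invariants and the antipode formula. -/

namespace StronglySeparableExt

section ModuleAlgebra

variable {k N M : Type*} [Field k] [Ring N] [Algebra k N] [Ring M] [Algebra k M]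
  {D : StronglySeparableExt k N M} {T : N →ₗ[k] k}

/-- Paired with `b'`, both sides give `⟨a, b'b⟩`. -/
theorem actA_eq_standardAct (hT : D.IsMarkovTrace T) {w : D.V} (hperf : (D.pairing T w).IsPerfPair)
    {CA : Coalgebra k D.A} (hCA : D.IsCanonicalOnA T w CA) (b : D.B) (a : D.A) :
    D.actA b a = D.standardAct T w CA b a := by
  refine hperf.bijective_left.1 (LinearMap.ext fun b' => ?_)
  have h : ∀ t : D.A ⊗[k] D.A, D.pairing T w (TensorProduct.rid k D.A
      (LinearMap.lTensor D.A ((D.pairing T w).flip b) t)) b' =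
      LinearMap.mul' k k (TensorProduct.map ((D.pairing T w).flip b')
        ((D.pairing T w).flip b) t) := by
    intro t
    induction t with
    | zero => simp
    | add x y hx hy => simp only [map_add, LinearMap.add_apply, hx, hy]
    | tmul x y => simp [mul_comm]
  rw [standardAct, h, hCA.comul, pairing_apply hT, pairing_apply hT, map_mul,
    Module.End.mul_apply]

/-- A comultiplication rule for the action on `A` extends to `M₁`. -/
theorem act_mul_of_actA_mul (hdepth : D.IsDepthTwo) {b : D.B} {t : D.B ⊗[k] D.B}
    (h : ∀ x y : D.A, LinearMap.mul' k D.A (TensorProduct.map (D.actA.toLinearMap.flip x)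
      (D.actA.toLinearMap.flip y) t) = D.actA b (x * y)) (x y : D.Alg) :
    D.act b (x * y) =
      LinearMap.mul' k D.Alg (TensorProduct.map (D.act.flip x) (D.act.flip y) t) := by
  obtain ⟨⟨m, z, z', hz, hzd⟩, -⟩ := hdepth
  have hA : ∀ (t : D.B ⊗[k] D.B) (x y : D.A), ((LinearMap.mul' k D.A (TensorProduct.map
      (D.actA.toLinearMap.flip x) (D.actA.toLinearMap.flip y) t) : D.A) : D.Alg) =
      LinearMap.mul' k D.Alg (TensorProduct.map (D.act.flip x) (D.act.flip y) t) := by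
    intro t x y
    induction t with
    | zero => simp
    | add x y hx hy => simp only [map_add, Subalgebra.coe_add, hx, hy]
    | tmul x y => simp [act_apply]
  have hl : ∀ (t : D.B ⊗[k] D.B) (m : M) (x y : D.Alg), LinearMap.mul' k D.Alg
      (TensorProduct.map (D.act.flip (D.basic.incl m * x)) (D.act.flip y) t) =
      D.basic.incl m * LinearMap.mul' k D.Alg
        (TensorProduct.map (D.act.flip x) (D.act.flip y) t) := by
    intro t m x y
    induction t with
    | zero => simp
    | add x y hx hy => simp only [map_add, mul_add, hx, hy]
    | tmul x y => simp [act_leftMul_mul, mul_assoc]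
  have hr : ∀ (t : D.B ⊗[k] D.B) (m : M) (x y : D.Alg), LinearMap.mul' k D.Alg
      (TensorProduct.map (D.act.flip x) (D.act.flip (y * D.basic.incl m)) t) =
      LinearMap.mul' k D.Alg
        (TensorProduct.map (D.act.flip x) (D.act.flip y) t) * D.basic.incl m := by
    intro t m x y
    induction t with
    | zero => simp
    | add x y hx hy => simp only [map_add, add_mul, hx, hy]
    | tmul x y => simp [act_mul_leftMul, mul_assoc]
  -- With `x` in `MA` and `y` in `AM`, the outer factors from `M` pass through every bimodule
  -- endomorphism, leaving a product of two elements of `A`.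
  have hx : x ∈ (⊤ : Submodule k D.Alg) := trivial
  rw [← span_leftMul_mul_A (fun j => (hz j).2) hzd] at hx
  have hy : y ∈ (⊤ : Submodule k D.Alg) := trivial
  rw [← span_A_mul_leftMul (fun j => (hz j).1) hzd] at hy
  induction hx using Submodule.span_induction with
  | zero => simp
  | add x x' _ _ h1 h2 =>
    simp only [add_mul, map_add, h1, h2, TensorProduct.map_add_left, LinearMap.add_apply]
  | smul c x _ h1 =>
    simp only [smul_mul_assoc, map_smul, h1, TensorProduct.map_smul_left, LinearMap.smul_apply]
  | mem x hx =>
    obtain ⟨m, a, rfl⟩ := hx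
    rw [mul_assoc, act_leftMul_mul, hl]
    congr 1
    induction hy using Submodule.span_induction with
    | zero => simp
    | add x x' _ _ h1 h2 =>
      simp only [mul_add, map_add, h1, h2, TensorProduct.map_add_right, LinearMap.add_apply]
    | smul c x _ h1 =>
      simp only [mul_smul_comm, map_smul, h1, TensorProduct.map_smul_right, LinearMap.smul_apply]
    | mem y hy =>
      obtain ⟨a', m', rfl⟩ := hy
      rw [← mul_assoc, act_mul_leftMul, hr, ← hA, h, act_apply]
      rfl

theorem act_eq_iff (hdepth : D.IsDepthTwo) {w : D.V} {CA : Coalgebra k D.A}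
    (h : ∀ (b : D.B) (a : D.A), D.act b a = D.standardAct T w CA b a)
    (act' : D.B →ₗ[k] D.Alg →ₗ[k] D.Alg) :
    (∀ (b : D.B) (m : M) (a : D.A),
      act' b (D.basic.incl m * a) = D.basic.incl m * D.standardAct T w CA b a) ↔
    act' = D.act := by
  obtain ⟨⟨m, z, z', hz, hzd⟩, -⟩ := hdepth
  refine ⟨fun h' => LinearMap.ext fun b => ?_, ?_⟩
  · refine LinearMap.ext_on (span_leftMul_mul_A (fun j => (hz j).2) hzd) ?_
    rintro _ ⟨m, a, rfl⟩
    rw [h', act_leftMul_mul, h]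
  · rintro rfl b m a
    rw [act_leftMul_mul, h]

/-- An element `x` with `b(x) = b(1) x` for all `b ∈ B` lies in `M`, and conversely. -/
theorem act_eq_act_one_mul_iff (hdepth : D.IsDepthTwo) (x : D.Alg) :
    (∀ b : D.B, D.act b x = D.act b 1 * x) ↔ x ∈ Set.range D.basic.incl := by
  constructor
  · intro h
    obtain ⟨-, ⟨m', u, v, hu, huv⟩⟩ := hdepth
    -- Writing `e₂ = ∑ c j v j` with `v j ∈ B` turns the hypothesis into `e₂(x) = e₂(1) x`, that is,
    -- `E_M(x) = x`.
    obtain ⟨c, hc⟩ := toEnd_eq_sum (fun j => (hu j).2) huv D.basic.jones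
    have h1 := hc x
    simp only [h _] at h1
    simp only [← mul_assoc] at h1
    rw [← Finset.sum_mul, ← hc, toEnd_jones, toEnd_jones, D.basic.E_one, map_one, one_mul] at h1
    exact ⟨_, h1⟩
  · rintro ⟨m, rfl⟩ b
    rw [← act_mul_leftMul, one_mul]

/-- The hypothesis on `b'` is the one satisfied by `S(b)` (`star_S`). Moving `b'` past `e₂` as its
adjoint sends `wa` to `w b(cwa) = w b(a)`, and the two Jones idempotents again cancel `λ⁻²`. -/
theorem pairing_eq_trace₂_antipode (hT : D.IsMarkovTrace T) {w c : D.V} (hcw : c * w = 1)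
    (a : D.A) (b b' : D.B) (hb : (D.basic.adj b' : D.basic.Alg) =
      D.basic.leftMul w * b * D.basic.leftMul c) :
    D.pairing T w a b = (D.lam⁻¹) ^ 2 *
      D.trace₂ T ((b' : D.basic.Alg) * D.e₁ * D.e₂ * D.inclV w * D.inclA a) := by
  have h1 : D.e₂ * D.basic.basic.incl ((w : D.Alg) * a) * b' =
      D.e₂ * D.basic.basic.incl ((w : D.Alg) * D.actA b a) := by
    refine (D.basic.jones_leftMul_mul_mem_A b' _).trans ?_
    rw [hb, map_mul D.basic.toEnd, map_mul D.basic.toEnd, Module.End.mul_apply, Module.End.mul_apply, toEnd_leftMul,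
      toEnd_leftMul, ← mul_assoc, ← Subalgebra.coe_mul, hcw]
    simp only [OneMemClass.coe_one, one_mul]
    rfl
  have h2 : (D.e₂ * (D.inclV w * D.inclA a)) * ((b' : D.basic.Alg) * D.e₁) =
      D.e₂ * D.basic.basic.incl ((w : D.Alg) * D.actA b a * D.jones) := by
    have h : D.inclV w * D.inclA a = D.basic.basic.incl ((w : D.Alg) * a) :=
      (map_mul D.basic.basic.incl _ _).symm
    rw [h, ← mul_assoc, h1, map_mul D.basic.basic.incl _ D.jones, mul_assoc]
    rfl
  rw [mul_assoc _ (D.inclV w), mul_assoc _ D.e₂, trace₂_mul_comm hT, h2, trace₂_mul_comm hT]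
  have h3 := trace₂_incl_mul_e₂_mul_incl (D := D) (T := T)
    ((w : D.Alg) * D.actA b a * D.jones) 1
  rw [map_one, mul_one, mul_one] at h3
  rw [h3, trace₁_mul_mul_jones, pairing_apply hT, counitA_apply]
  have := D.lam_ne_zero
  field_simp

end ModuleAlgebra

end StronglySeparableExt

end

/-! ### The main theorem. -/

theorem mainTheorem6 {k N M : Type*} [Field k] [Ring N] [Algebra k N] [Ring M] [Algebra k M]
    (D : StronglySeparableExt k N M) (T : N →ₗ[k] k)
    (hT : D.IsMarkovTrace T) (hsymm : D.IsSymmetric)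
    (hprod : ∑ i, D.y i * D.x i = algebraMap k M D.lam⁻¹)
    (hU : IsKanzakiSeparable k D.U) (hTU : D.TraceNondegOnU T)
    (hdepth : D.IsDepthTwo) :
    ∃ (f : D.V ⊗[k] D.V) (w : D.V),
      IsSymmSeparabilityElement k f ∧
      (∀ f' : D.V ⊗[k] D.V, IsSymmSeparabilityElement k f' → f' = f) ∧
      w * D.sliceTrace T f = 1 ∧ D.sliceTrace T f * w = 1 ∧
      (D.pairing T w).IsPerfPair ∧
      ∃ (W : WeakHopfAlgebra k D.B) (CA : Coalgebra k D.A),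
        D.IsCanonicalOnB T w W ∧ D.IsCanonicalOnA T w CA ∧
        W.IsModuleAlgebra D.act ∧
        Submodule.span k {x : D.Alg | ∃ (m : M) (a : D.A), x = D.basic.incl m * a} = ⊤ ∧
        (∀ act' : D.B →ₗ[k] D.Alg →ₗ[k] D.Alg,
          (∀ (b : D.B) (m : M) (a : D.A),
            act' b (D.basic.incl m * a) = D.basic.incl m * D.standardAct T w CA b a) ↔
          act' = D.act) ∧
        (∀ (b : D.B) (a : D.A), D.act b a = D.standardAct T w CA b a) ∧
        W.invariants D.act = Set.range D.basic.incl := by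
  open StronglySeparableExt in
  obtain ⟨fU, hfU⟩ := hU
  have hf := hfU.map_anti D.equivUV D.equivUV_mul
  set f := TensorProduct.map D.equivUV.toLinearMap D.equivUV.toLinearMap fU
  obtain ⟨hfdV, w, c, s, hcf, hwc, hcw, hc, hs, hs', hsum, hsum'⟩ :=
    hf.exists_inverse (D.trace₁ T ∘ₗ D.V.val.toLinearMap)
      (fun x y => trace₁_mul_comm hT x y) (trace₁_nondeg_V hT hprod hTU)
  have hfdU : FiniteDimensional k D.U := FiniteDimensional.of_injective
    D.equivUV.toLinearMap D.equivUV.injective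
  have hperf := isPerfPair_pairing hT hTU hdepth hwc hcw
  obtain ⟨G, hφ, hε, hw, hι, hL, hstar⟩ := exists_galoisSystem hT hprod hTU hdepth hwc hcw hc
    hs hs' hsum hsum' hperf
  have hpair : G.pair = D.pairing T w := LinearMap.ext₂ fun a b => by
    rw [G.pair_apply, hφ, hε, pairing_apply hT]
  have hspan := hdepth.1.elim fun m ⟨z, z', hz, hzd⟩ =>
    (span_leftMul_mul_A (fun j => (hz j).2) hzd)
  have hfdA : FiniteDimensional k D.A := hdepth.1.elim fun m ⟨z, z', hz, hzd⟩ =>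
    finiteDimensional_A (fun j => (hz j).1) hzd
  have hfdB : FiniteDimensional k D.B :=
    FiniteDimensional.of_injective (D.pairing T w).flip hperf.bijective_right.1
  obtain ⟨W, hWΔ, hWε, hWS, hWmul, hWt⟩ := G.exists_weakHopfAlgebra
  obtain ⟨CA, hCAΔ, hCAε⟩ := exists_coalgebra_of_isPerfPair (D.pairing T w).flip hperf.flip
  have hCA : D.IsCanonicalOnA T w CA := ⟨fun a b b' => hCAΔ b b' a, hCAε⟩
  rw [hpair] at hWΔ hWε
  rw [hφ] at hWmul hWt
  have hstd : ∀ (b : D.B) (a : D.A), D.act b a = D.standardAct T w CA b a := fun b a => by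
    rw [← actA_eq_standardAct hT hperf hCA, act_apply, coe_actA]
  -- As `ε_t(b)` is left multiplication by `b(1) ∈ V`, invariance of `x` reads `b(x) = b(1) x`.
  have ht : ∀ (b : D.B) (x : D.Alg), D.act (W.targetCounit b) x = D.act b 1 * x := by
    intro b x
    have h1 : D.act b 1 ∈ D.V := by
      rw [act_apply]
      exact D.toEnd_mem_V b 1
    rw [hWt b ⟨_, h1⟩ (Subtype.ext (by rw [hι]; exact (act_apply D b 1).symm)), act_apply, hL]
    rfl
  have hcS : G.c = c := by
    rw [← one_mul G.c, ← hcw, mul_assoc, ← hw, G.w_mul_c, mul_one]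
  refine ⟨f, w, hf, fun f' hf' => hf.unique hf', ?_, ?_, hperf, W, CA,
    ⟨hWΔ, hWε, fun a b => ?_⟩, hCA, ?_, hspan, act_eq_iff hdepth hstd, hstd, ?_⟩
  · exact (congrArg (w * ·) hcf).trans hwc
  · exact (congrArg (· * w) hcf).trans hcw
  · refine pairing_eq_trace₂_antipode hT hcw a b _ ?_
    have h := G.star_S b
    rw [hstar, hw, hcS] at h
    rw [hWS, ← hL, ← hL]
    exact congrArg Subtype.val h
  · refine ⟨fun x => ?_, fun h g x => ?_, fun b => act_mul_of_actA_mul hdepth (hWmul b),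
      fun b => ?_⟩
    · rw [act_apply]
      simp
    · simp only [act_apply, Subalgebra.coe_mul, map_mul, Module.End.mul_apply]
    · rw [ht, mul_one]
  · ext x
    rw [← act_eq_act_one_mul_iff hdepth]
    simp only [WeakHopfAlgebra.invariants, Set.mem_ofPred_eq, ht]
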